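/- Let $p\ge 1$, $1\le j\le p$, $n=(n_1,\dots,n_p)\in\mathbb N_0^p$, and let $\gamma=(\gamma_1,\dots,\gamma_{p+1})\in\mathbb R^{p+1}$ with $\gamma_2,\dots,\gamma_{p+1}\notin\{-1,-2,\dots\}$. Write $N_1^k=n_1+\dots+n_k$, $\gamma_1^k=\gamma_1+\dots+\gamma_k$, $Z_1^k=z_1+\dots+z_k$ for $k\le p$, and $Z_1^{p+1}=1$ (i.e. $z_{p+1}=1-z_1-\dots-z_p$). With $P_m(x;\alpha,\beta)=\frac{(\alpha+1)_m}{m!}\,{}_2F_1\!\left(-m,m+\alpha+\beta+1;\alpha+1;\frac{1-x}2\right)$ (as a polynomial also in $\alpha,\beta$), the multivariable Jacobi polynomials on the simplex are the polynomials in $z=(z_1,\dots,z_p)$ $$J_p(n;z;\gamma)=(-1)^{|n|}\prod_{k=1}^p\frac{n_k!\,(Z_1^{k+1})^{n_k}}{(\gamma_{k+1}+1)_{n_k}}\,P_{n_k}\!\left(1-\frac{2Z_1^k}{Z_1^{k+1}};\,2N_1^{k-1}+\gamma_1^k+k-1,\ \gamma_{k+1}\right).$$ *Operators in $z$.* $$\hat{\mathfrak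 L}^z_j=-2\!\!\sum_{1\le l<m\le\min(j+1,p)}\!\! z_lz_m\partial_{z_l}\partial_{z_m}+\sum_{m=1}^{\min(j+1,p)}\! z_m(Z_1^{j+1}-z_m)\partial_{z_m}^2+\sum_{m=1}^{\min(j+1,p)}\!\big((\gamma_m+1)Z_1^{j+1}-(\gamma_1^{j+1}+j+1)z_m\big)\partial_{z_m}.$$ *Operators in $n$.* For sequences $x_k,\beta_k$ put $B_k^{0,0}=x_k(x_k+\beta_k)+x_{k+1}(x_{k+1}+\beta_{k+1})+\frac12(\beta_k+1)(\beta_{k+1}-1)$, $B_k^{0,1}=(x_{k+1}+x_k+\beta_{k+1})(x_{k+1}-x_k+\beta_{k+1}-\beta_k)$, $B_k^{1,0}=(x_{k+1}-x_k)(x_{k+1}+x_k+\beta_{k+1})$, $B_k^{1,1}=(x_{k+1}+x_k+\beta_{k+1})(x_{k+1}+x_k+\beta_{k+1}+1)$, $b_k^0=(2x_k+\beta_k+1)(2x_k+\beta_k-1)$, $b_k^1=(2x_k+\beta_k+1)(2x_k+\beta_k)$; replacing an upper index $1$ by $-1$ means substituting $x_i\mapsto -x_i-\beta_i$ for the corresponding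 variable ($i=k$ for the first index, $i=k+1$ for the second). For $\nu\in\{0,\pm1\}^j$, with $\nu_k=0$ for $k=0$ and $k>j$, let $$C_\nu=2^{\#\{k:\,1\le k\le j,\ \nu_k=0\}}\;\prod_{k=0}^{j}B_k^{\nu_k,\nu_{k+1}}\Big/\prod_{k=1}^{j}b_k^{\nu_k},$$ and let $L_\nu(\beta_0,N;n,\gamma)$ be the result of substituting in $C_\nu$: $x_0=0$, $x_{p+1}=N$, $x_k=N_1^{p+1-k}+\gamma_1^{p+2-k}+N+p+1-k$ $(1\le k\le p)$, $\beta_k=-\gamma_1^{p+2-k}-(p+2-k)-2N+1$ $(1\le k\le p+1)$, with $\beta_0$ kept. Define $$\hat L_\nu(n;\gamma)=\lim_{N\to\infty}\frac1N\lim_{\beta_0\to\infty}\frac1{\beta_0}L_\nu(\beta_0,N;n,\gamma),\qquad \hat{\mathfrak L}^n_j=\sum_{0\ne\nu\in\{0,\pm1\}^j}\hat L_\nu(n;\gamma)\,(T_\nu-1),$$ where $(T_\nu F)(n)=F(n')$, $n'_m=n_m+\nu_{p+1-m}-\nu_{p+2-m}$. Call $\gamma$ *generic for $n$* if $2N_1^m+\gamma_1^{m+1}+m\notin\{-1,0,1\}$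 for $p+1-j\le m\le p$ (no denominator vanishes). **Theorem.** The polynomials $J_p(n;z;\gamma)$ are bispectral: (a) $\hat{\mathfrak L}^z_j J_p(n;z;\gamma)=\hat\mu_j(n)\,J_p(n;z;\gamma)$ with $\hat\mu_j(n)=-(n_1+\dots+n_j)(n_1+\dots+n_j+j+\gamma_1+\dots+\gamma_{j+1})$. (b) The two limits defining $\hat L_\nu(n;\gamma)$ exist for all $\gamma\in\mathbb R^{p+1}$ that are generic for $n$. If $\gamma$ is generic for $n$, or if $\gamma_i>-1$ for all $i$ (in which case $\hat L_\nu(n;\gamma)$ means the limit of $\hat L_\nu(n;\gamma')$ as $\gamma'\to\gamma$ through parameters generic for $n$, and this limit exists), then $$\hat{\mathfrak L}^n_j J_p(n;z;\gamma)=\hat\kappa_j(z)\,J_p(n;z;\gamma),\qquad \hat\kappa_j(z)=1-z_1-\dots-z_{p+1-j},$$ as an identity of polynomials in $z$, whatever values are assigned to $J_p$ at indices in $\mathbb Z^p\setminus\mathbb N_0^p$. -/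

import Mathlib

open Filter Topology

noncomputable section

namespace SimplexJacobi

/-! ### Sequences, partial sums, Pochhammer symbols

Vectors `(v_1, …, v_m)` are functions `v : Fin m → R`; the mathematical index `k` is the
element of `Fin m` with value `k - 1`. -/

/-- `v_1 + v_2 + ⋯ + v_k` (so `0` for `k = 0`). -/
def psum {R : Type*} [AddCommMonoid R] {m : ℕ} (v : Fin m → R) (k : ℕ) : R :=
  ∑ i : Fin m, if (i : ℕ) < k then v i else 0

/-- The Pochhammer symbol `(a)_n = a (a + 1) ⋯ (a + n - 1)`. -/
def poch (a : ℝ) (n : ℕ) : ℝ := ∏ i ∈ Finset.range n, (a + i)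

/-! ### The Jacobi polynomials in one variable and on the simplex -/

/-- The coefficient of `((1 - x) / 2) ^ i` in the Jacobi polynomial `P_n(x; α, β)`, that is
`(α+1)_n / n! * (-n)_i (n+α+β+1)_i / ((α+1)_i i!)`, written with
`(α+1)_n / (α+1)_i = (α+1+i)_{n-i}`. -/
def jacobiCoeff (n : ℕ) (α β : ℝ) (i : ℕ) : ℝ :=
  poch (-(n : ℝ)) i * poch (n + α + β + 1) i * poch (α + 1 + i) (n - i) /
    ((n.factorial : ℝ) * (i.factorial : ℝ))

/-- The Jacobi polynomial `P_n(x; α, β)` in one variable. -/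
def jacobiP (n : ℕ) (α β x : ℝ) : ℝ :=
  ∑ i ∈ Finset.range (n + 1), jacobiCoeff n α β i * ((1 - x) / 2) ^ i

/-- The polynomial `v ^ n * P_n(1 - 2 u / v; α, β)`. -/
def jacobiHom {p : ℕ} (n : ℕ) (α β : ℝ) (u v : MvPolynomial (Fin p) ℝ) :
    MvPolynomial (Fin p) ℝ :=
  ∑ i ∈ Finset.range (n + 1), MvPolynomial.C (jacobiCoeff n α β i) * u ^ i * v ^ (n - i)

/-- `Z_1^k = z_1 + ⋯ + z_k` for `k ≤ p`, and `Z_1^{p+1} = 1` (because `z_{p+1} = 1 - |z|`). -/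
def Zsum (p k : ℕ) : MvPolynomial (Fin p) ℝ :=
  if k ≤ p then psum (fun i : Fin p => MvPolynomial.X i) k else 1

/-- The multivariable Jacobi polynomial `J_p(n; z; γ)`:
`(-1)^|n| ∏_{k=1}^p n_k! (Z_1^{k+1})^{n_k} / (γ_{k+1}+1)_{n_k} *
  P_{n_k}(1 - 2 Z_1^k / Z_1^{k+1}; 2 N_1^{k-1} + γ_1^k + k - 1, γ_{k+1})`,
with `N_1^{k-1} = n_1 + ⋯ + n_{k-1}` and `γ_1^k = γ_1 + ⋯ + γ_k`. -/
def jacobiSimplex (p : ℕ) (γ : Fin (p + 1) → ℝ) (n : Fin p → ℕ) : MvPolynomial (Fin p) ℝ :=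
  MvPolynomial.C ((-1) ^ (∑ k, n k)) *
    ∏ k : Fin p,
      MvPolynomial.C (((n k).factorial : ℝ) / poch (γ k.succ + 1) (n k)) *
        jacobiHom (n k) (2 * ((psum n (k : ℕ) : ℕ) : ℝ) + psum γ ((k : ℕ) + 1) + (k : ℕ)) (γ k.succ)
          (Zsum p ((k : ℕ) + 1)) (Zsum p ((k : ℕ) + 2))

/-- `jacobiP` is the usual hypergeometric expression whenever the latter makes sense. -/
theorem jacobiP_eq (n : ℕ) (α β x : ℝ) (h : poch (α + 1) n ≠ 0) :
    jacobiP n α β x = poch (α + 1) n / n.factorial *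
      ∑ i ∈ Finset.range (n + 1), poch (-(n : ℝ)) i * poch (n + α + β + 1) i /
        (poch (α + 1) i * i.factorial) * ((1 - x) / 2) ^ i := by
  unfold jacobiP
  rw [Finset.mul_sum]
  refine Finset.sum_congr rfl fun i hi => ?_
  have hin : i ≤ n := Nat.lt_succ_iff.mp (Finset.mem_range.mp hi)
  have hsplit : poch (α + 1) n = poch (α + 1) i * poch (α + 1 + i) (n - i) := by
    unfold poch
    have h1 := Finset.prod_range_add (fun m : ℕ => α + 1 + (m : ℝ)) i (n - i)
    rw [Nat.add_sub_cancel' hin] at h1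
    rw [h1]
    congr 1
    refine Finset.prod_congr rfl fun m _ => ?_
    push_cast
    ring
  have hi0 : poch (α + 1) i ≠ 0 := fun h0 => h (by rw [hsplit, h0, zero_mul])
  unfold jacobiCoeff
  rw [hsplit]
  field_simp

/-- At a point where no `Z_1^{k+1}` vanishes, the value of `jacobiSimplex` is given by the product
formula for `J_p(n; z; γ)`. -/
theorem eval_jacobiSimplex (p : ℕ) (γ : Fin (p + 1) → ℝ) (n : Fin p → ℕ) (z : Fin p → ℝ)
    (hz : ∀ k : Fin p, MvPolynomial.eval z (Zsum p ((k : ℕ) + 2)) ≠ 0) :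
    MvPolynomial.eval z (jacobiSimplex p γ n) =
      (-1) ^ (∑ k, n k) *
        ∏ k : Fin p,
          ((n k).factorial : ℝ) * MvPolynomial.eval z (Zsum p ((k : ℕ) + 2)) ^ n k /
              poch (γ k.succ + 1) (n k) *
            jacobiP (n k) (2 * ((psum n (k : ℕ) : ℕ) : ℝ) + psum γ ((k : ℕ) + 1) + (k : ℕ)) (γ k.succ)
              (1 - 2 * (MvPolynomial.eval z (Zsum p ((k : ℕ) + 1)) /
                MvPolynomial.eval z (Zsum p ((k : ℕ) + 2)))) := by
  unfold jacobiSimplex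
  rw [map_mul, map_prod, MvPolynomial.eval_C]
  congr 1
  refine Finset.prod_congr rfl fun k _ => ?_
  rw [map_mul, MvPolynomial.eval_C, mul_div_right_comm, mul_assoc]
  congr 1
  unfold jacobiHom jacobiP
  rw [map_sum, Finset.mul_sum]
  refine Finset.sum_congr rfl fun i hi => ?_
  have hin : i ≤ n k := Nat.lt_succ_iff.mp (Finset.mem_range.mp hi)
  have hk := hz k
  simp only [map_mul, map_pow, MvPolynomial.eval_C]
  generalize MvPolynomial.eval z (Zsum p ((k : ℕ) + 2)) = v at hk
  generalize MvPolynomial.eval z (Zsum p ((k : ℕ) + 1)) = u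
  have h1 : (1 - (1 - 2 * (u / v))) / 2 = u / v := by ring
  have h2 : v ^ n k = v ^ i * v ^ (n k - i) := by rw [← pow_add, Nat.add_sub_cancel' hin]
  rw [h1, h2, div_pow]
  field_simp

/-! ### The second-order differential operators in `z` -/

/-- The operator `L_j^z`:
`-2 ∑_{l < m ≤ min(j+1,p)} z_l z_m ∂_l ∂_m + ∑_{m ≤ min(j+1,p)} z_m (Z_1^{j+1} - z_m) ∂_m²
  + ∑_{m ≤ min(j+1,p)} ((γ_m + 1) Z_1^{j+1} - (γ_1^{j+1} + j + 1) z_m) ∂_m`. -/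
def opZ (p j : ℕ) (γ : Fin (p + 1) → ℝ) (f : MvPolynomial (Fin p) ℝ) :
    MvPolynomial (Fin p) ℝ :=
  -2 * (∑ l : Fin p, ∑ m : Fin p, if l < m ∧ (m : ℕ) < j + 1 then
      MvPolynomial.X l * MvPolynomial.X m * MvPolynomial.pderiv l (MvPolynomial.pderiv m f)
      else 0)
  + (∑ m : Fin p, if (m : ℕ) < j + 1 then
      MvPolynomial.X m * (Zsum p (j + 1) - MvPolynomial.X m) *
        MvPolynomial.pderiv m (MvPolynomial.pderiv m f)
      else 0)
  + (∑ m : Fin p, if (m : ℕ) < j + 1 then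
      (MvPolynomial.C (γ m.castSucc + 1) * Zsum p (j + 1)
        - MvPolynomial.C (psum γ (j + 1) + j + 1) * MvPolynomial.X m) *
        MvPolynomial.pderiv m f
      else 0)

/-- `-(n_1 + ⋯ + n_j) (n_1 + ⋯ + n_j + j + γ_1 + ⋯ + γ_{j+1})`. -/
def muHat (p j : ℕ) (γ : Fin (p + 1) → ℝ) (n : Fin p → ℕ) : ℝ :=
  -((psum n j : ℕ) : ℝ) * (((psum n j : ℕ) : ℝ) + j + psum γ (j + 1))

/-- `1 - z_1 - z_2 - ⋯ - z_{p+1-j}` (used for `1 ≤ j ≤ p`). -/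
def kappaHat (p j : ℕ) : MvPolynomial (Fin p) ℝ :=
  1 - psum (fun i : Fin p => MvPolynomial.X i) (p + 1 - j)

/-! ### The coefficients of the Racah difference operators -/

/-- `B_i^{s,t}` as a function of `b = β_i`, `b' = β_{i+1}`, `x = x_i`, `x' = x_{i+1}`. A negative
index is obtained from a positive one by the involution `x ↦ -x - b`, resp. `x' ↦ -x' - b'`. -/
def racahB (b b' x x' : ℝ) : SignType → SignType → ℝ
  | .zero, .zero => x * (x + b) + x' * (x' + b') + (b + 1) * (b' - 1) / 2
  | .zero, .pos => B01 x x'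
  | .pos, .zero => B10 x x'
  | .pos, .pos => B11 x x'
  | .neg, .zero => B10 (-x - b) x'
  | .neg, .pos => B11 (-x - b) x'
  | .zero, .neg => B01 x (-x' - b')
  | .pos, .neg => B11 x (-x' - b')
  | .neg, .neg => B11 (-x - b) (-x' - b')
where
  B01 (x x' : ℝ) : ℝ := (x' + x + b') * (x' - x + b' - b)
  B10 (x x' : ℝ) : ℝ := (x' - x) * (x' + x + b')
  B11 (x x' : ℝ) : ℝ := (x' + x + b') * (x' + x + b' + 1)

/-- `b_i^s` as a function of `b = β_i`, `x = x_i`. -/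
def racahb (b x : ℝ) : SignType → ℝ
  | .zero => (2 * x + b + 1) * (2 * x + b - 1)
  | .pos => (2 * x + b + 1) * (2 * x + b)
  | .neg => (2 * (-x - b) + b + 1) * (2 * (-x - b) + b)

/-- The entry `ν_k` of `ν = (ν_1, …, ν_j)`, with `ν_k = 0` for `k = 0` and for `k > j`. -/
def entry {j : ℕ} (ν : Fin j → SignType) (k : ℕ) : SignType :=
  if h : 1 ≤ k ∧ k ≤ j then ν ⟨k - 1, by omega⟩ else 0

/-- `C_ν^{(j)} = 2^{j - |ν⁺| - |ν⁻|} ∏_{k=0}^j B_k^{ν_k,ν_{k+1}} / ∏_{k=1}^j b_k^{ν_k}`, the coefficient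
of `E_x^ν` in the Racah operator of order `j`, as a function of the sequences `β` and `x`. -/
def racahC {j : ℕ} (β x : ℕ → ℝ) (ν : Fin j → SignType) : ℝ :=
  2 ^ (Finset.univ.filter fun i => ν i = 0).card *
    (∏ k ∈ Finset.range (j + 1),
      racahB (β k) (β (k + 1)) (x k) (x (k + 1)) (entry ν k) (entry ν (k + 1))) /
    ∏ k ∈ Finset.Icc 1 j, racahb (β k) (x k) (entry ν k)

/-! ### The dual operators in `n` and their limits -/

/-- The Hahn parametrization `β_k = β_0 + γ_1^k + k`. -/
def hahnBeta {p : ℕ} (γ : Fin (p + 1) → ℝ) (β₀ : ℝ) (k : ℕ) : ℝ := β₀ + psum γ k + k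

/-- The images of `β_0, …, β_{p+1}` under the duality map: `β_0 ↦ β_0` and
`β_k ↦ β_0 - β_{p+2-k} - 2 N + 1` for `1 ≤ k ≤ p + 1`. -/
def dualBeta {p : ℕ} (γ : Fin (p + 1) → ℝ) (β₀ N : ℝ) (k : ℕ) : ℝ :=
  if k = 0 then β₀ else β₀ - hahnBeta γ β₀ (p + 2 - k) - 2 * N + 1

/-- The images of `x_0 = 0`, of `x_1, …, x_p` and of `x_{p+1} = N` under the duality map:
`x_k ↦ n_1 + ⋯ + n_{p+1-k} + β_{p+2-k} - β_0 + N - 1` for `1 ≤ k ≤ p`. -/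
def dualX {p : ℕ} (γ : Fin (p + 1) → ℝ) (β₀ N : ℝ) (n : Fin p → ℕ) (k : ℕ) : ℝ :=
  if k = 0 then 0
  else if k = p + 1 then N
  else ((psum n (p + 1 - k) : ℕ) : ℝ) + hahnBeta γ β₀ (p + 2 - k) - β₀ + N - 1

/-- The coefficient of the dual Racah operator `L_j^n(β_0, γ, N)` at the dual of the shift `E_x^ν`. -/
def coeffRacah (p j : ℕ) (γ : Fin (p + 1) → ℝ) (β₀ N : ℝ) (n : Fin p → ℕ)
    (ν : Fin j → SignType) : ℝ :=
  racahC (dualBeta γ β₀ N) (dualX γ β₀ N n) ν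

/-- The corresponding coefficient in the Hahn case, `lim_{β_0 → ∞} (1/β_0) coeffRacah`. -/
def coeffHahn (p j : ℕ) (γ : Fin (p + 1) → ℝ) (N : ℝ) (n : Fin p → ℕ)
    (ν : Fin j → SignType) : ℝ :=
  limUnder atTop fun β₀ : ℝ => coeffRacah p j γ β₀ N n ν / β₀

/-- The corresponding coefficient in the Jacobi case, `lim_{N → ∞} (1/N) coeffHahn`. -/
def coeffJacobi (p j : ℕ) (γ : Fin (p + 1) → ℝ) (n : Fin p → ℕ) (ν : Fin j → SignType) : ℝ :=
  limUnder atTop fun N : ℝ => coeffHahn p j γ N n ν / N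

/-- The parameters `γ` for which no denominator in the coefficients of the operator of order `j`
vanishes at `n`: the factors of the dual `b_k^s`, `1 ≤ k ≤ j`, are up to sign
`2 N_1^m + γ_1^{m+1} + m + ε` with `m = p + 1 - k` and `ε ∈ {-1, 0, 1}`. -/
def genericParams (p j : ℕ) (n : Fin p → ℕ) : Set (Fin (p + 1) → ℝ) :=
  {γ | ∀ m : ℕ, p + 1 - j ≤ m → m ≤ p → ∀ ε : SignType,
    2 * ((psum n m : ℕ) : ℝ) + psum γ (m + 1) + m + (ε : ℝ) ≠ 0}

/-- The value at `n` of the coefficient of the operator `L_j^n` as a rational function with its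
removable singularities in `γ` removed: the limit of `coeffJacobi` along generic parameters
(it is `coeffJacobi` itself when `γ` is generic). -/
def coeffN (p j : ℕ) (γ : Fin (p + 1) → ℝ) (n : Fin p → ℕ) (ν : Fin j → SignType) : ℝ :=
  limUnder (𝓝[genericParams p j n] γ) fun γ' => coeffJacobi p j γ' n ν

/-- The point `n` moved by the dual of `E_x^ν`. Since `E_{x_k}` is sent to
`E_{n_{p+1-k}} E_{n_{p+2-k}}⁻¹` (with `E_{n_{p+1}} = 1`), the coordinate `n_m` becomes
`n_m + ν_{p+1-m} - ν_{p+2-m}`. -/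
def dualShift {p j : ℕ} (ν : Fin j → SignType) (n : Fin p → ℕ) : Fin p → ℤ := fun m =>
  (n m : ℤ) + (entry ν (p - (m : ℕ)) : ℤ) - (entry ν (p + 1 - (m : ℕ)) : ℤ)

/-- The difference operator `L_j^n = ∑_{ν ≠ 0} coeffN_ν (dual(E_x^ν) - 1)` applied to a function `F`
of `n ∈ ℤ^p` with polynomial values, evaluated at `n ∈ ℕ^p`. -/
def opN (p j : ℕ) (γ : Fin (p + 1) → ℝ) (F : (Fin p → ℤ) → MvPolynomial (Fin p) ℝ)
    (n : Fin p → ℕ) : MvPolynomial (Fin p) ℝ :=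
  ∑ ν : Fin j → SignType, if ν = 0 then 0 else
    MvPolynomial.C (coeffN p j γ n ν) * (F (dualShift ν n) - F fun i => (n i : ℤ))

end SimplexJacobi

end

open SimplexJacobi

namespace SimplexJacobi

/-! The two halves are independent.

Difference equation in `n`. Written in the partial sums of the indices, `J_p` is a product over
levels. With `(a, c)` two consecutive partial sums of `n`, `(u, v)` two consecutive partial sums of
`z`, and `g`, `h` the corresponding values of `levelParam`, the factor at a level is `F(a, c) =
v^(c-a) ₂F₁(a-c, a+c+h; h-g; (v-u)/v)`. This is the expansion at `x = -1`: its lower parameter is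
not affected by shifts of the indices, and its constant coefficient is `1`. Contiguity
(`jacobiFactor_contiguous`) gives `u^(1-s') F(a, c) = ∑_s W(s', s) v^(1-s) F(a+s', c+s)` for `s' ∈
{-1, 0, 1}`, where `W` is the quotient `B / b` of the Racah operator up to sign. The `v` of one
level is the `u` of the next, so the relations chain (`prod_mul_eq_sum_paths`) from `Z_1^{p+1-j}` up
to `Z_1^{p+1} = 1`, and `Z_1^{p+1-j} J = ∑_ν w_ν T_ν J` (`sum_pathWeight_mul`). At `z = (1, 0, …,
0)` every `J` equals `1`, so `∑_ν w_ν = 1` (`sum_pathWeight`); subtraction gives `-∑_ν w_ν (T_ν - 1)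
J = (1 - Z_1^{p+1-j}) J`.

It remains to identify the limits with `-w_ν`. In the dual variables only `B_0` involves `β_0` or,
after cancellation, `N`; it is affine in `β_0` with slope affine in `N` (`coeffJacobi_eq`). When all
`γ_i > -1`, a denominator can vanish only at a level with `c = 0`, where the singularity is
removable; `regConnCoeff` records the extended values.

Differential equation in `z`. In the coordinates `Z_1^1, …, Z_1^p` the operator of order `j`
involves only the first `j` derivatives (`opZ_eq_opPartialSums`), and the operator of order `j + 1`
is expressed by the one of order `j` and an Euler operator (`mul_opPartialSums_succ`). By induction
on `j`, homogeneity of the first `j` factors and the Jacobi equation of the next one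
(`jacobiHom_ode`) give the eigenvalue. -/

theorem poch_zero (a : ℝ) : poch a 0 = 1 := by simp [poch]

theorem poch_succ (a : ℝ) (k : ℕ) : poch a (k + 1) = poch a k * (a + k) := by
  simp [poch, Finset.prod_range_succ]

theorem poch_succ_left (a : ℝ) (k : ℕ) : poch a (k + 1) = a * poch (a + 1) k := by
  unfold poch
  rw [Finset.prod_range_succ']
  simp only [Nat.cast_zero, add_zero, Nat.cast_add, Nat.cast_one]
  rw [mul_comm]
  congr 1
  exact Finset.prod_congr rfl fun i _ => by ring

theorem sum_signType {M : Type*} [AddCommMonoid M] (f : SignType → M) :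
    ∑ s, f s = f (-1) + f 0 + f 1 := by
  rw [show (Finset.univ : Finset SignType) = {-1, 0, 1} by decide]
  rw [Finset.sum_insert (by decide), Finset.sum_insert (by decide), Finset.sum_singleton, add_assoc]

/-! ### Hypergeometric coefficients and connection coefficients in closed form. -/

/-- The coefficient `(A)_k (b)_k / ((c)_k k!)` of the Gauss hypergeometric series. -/
noncomputable def hypCoeff (A b c : ℝ) (k : ℕ) : ℝ :=
  poch A k * poch b k * (poch c k * k.factorial)⁻¹

/-- The sign which turns the coefficients of the Racah operators into connection coefficients. -/
def gaugeSign (s : SignType) : ℝ := if s = 0 then 1 else -1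

/-- The connection coefficients between Jacobi polynomials whose parameters are shifted by `s'`
and `s`. -/
noncomputable def connCoeff (a c g h : ℝ) (s' s : SignType) : ℝ :=
  gaugeSign s' * gaugeSign s * (if s = 0 then 2 else 1) *
    racahB (-h) (-g) (c + h) (a + g) s s' / racahb (-h) (c + h) s

section explicit
variable (a c g h : ℝ)

/-- The arguments of `racahB` are the dual variables `β_k = -h`, `β_{k+1} = -g`, `x_k = c + h`,
`x_{k+1} = a + g` at `N = 0`. In these closed forms the only denominators are `2c+h` and `2c+h±1`,
and factors `c - a` appear exactly where the shift lowers the degree. -/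
theorem connCoeff_zero_zero : connCoeff a c g h 0 0 =
    (2 * a * (a + g) + 2 * c * (c + h) + (h - 1) * (g + 1)) /
      ((2 * c + h + 1) * (2 * c + h - 1)) := by
  simp only [connCoeff, gaugeSign, if_true, one_mul]
  change 2 * ((c + h) * (c + h + -h) + (a + g) * (a + g + -g) + (-h + 1) * (-g - 1) / 2) /
    ((2 * (c + h) + -h + 1) * (2 * (c + h) + -h - 1)) = _
  congr 1 <;> ring

theorem connCoeff_zero_one : connCoeff a c g h 0 1 =
    (c - a + h - g) * (a + c + h) / ((2 * c + h + 1) * (2 * c + h)) := by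
  have h1 : (1 : SignType) ≠ 0 := by decide
  simp only [connCoeff, gaugeSign, if_true, if_neg h1]
  change 1 * -1 * 1 * ((a + g - (c + h)) * (a + g + (c + h) + -g)) /
    ((2 * (c + h) + -h + 1) * (2 * (c + h) + -h)) = _
  congr 1 <;> ring

theorem connCoeff_zero_neg : connCoeff a c g h 0 (-1) =
    (a + c + g) * (c - a) / ((2 * c + h - 1) * (2 * c + h)) := by
  have h1 : (-1 : SignType) ≠ 0 := by decide
  simp only [connCoeff, gaugeSign, if_true, if_neg h1]
  change 1 * -1 * 1 * ((a + g - (-(c + h) - -h)) * (a + g + (-(c + h) - -h) + -g)) /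
    ((2 * (-(c + h) - -h) + -h + 1) * (2 * (-(c + h) - -h) + -h)) = _
  congr 1 <;> ring

theorem connCoeff_one_zero : connCoeff a c g h 1 0 =
    2 * (a + c + h) * (c - a) / ((2 * c + h + 1) * (2 * c + h - 1)) := by
  have h1 : (1 : SignType) ≠ 0 := by decide
  simp only [connCoeff, gaugeSign, if_true, if_neg h1]
  change -1 * 1 * 2 * ((a + g + (c + h) + -g) * (a + g - (c + h) + -g - -h)) /
    ((2 * (c + h) + -h + 1) * (2 * (c + h) + -h - 1)) = _
  congr 1 <;> ring

theorem connCoeff_one_one : connCoeff a c g h 1 1 =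
    (a + c + h) * (a + c + h + 1) / ((2 * c + h + 1) * (2 * c + h)) := by
  have h1 : (1 : SignType) ≠ 0 := by decide
  simp only [connCoeff, gaugeSign, if_neg h1]
  change -1 * -1 * 1 * ((a + g + (c + h) + -g) * (a + g + (c + h) + -g + 1)) /
    ((2 * (c + h) + -h + 1) * (2 * (c + h) + -h)) = _
  congr 1 <;> ring

theorem connCoeff_one_neg : connCoeff a c g h 1 (-1) =
    (c - a) * (c - a - 1) / ((2 * c + h - 1) * (2 * c + h)) := by
  have h1 : (1 : SignType) ≠ 0 := by decide
  have h2 : (-1 : SignType) ≠ 0 := by decide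
  simp only [connCoeff, gaugeSign, if_neg h1, if_neg h2]
  change -1 * -1 * 1 * ((a + g + (-(c + h) - -h) + -g) * (a + g + (-(c + h) - -h) + -g + 1)) /
    ((2 * (-(c + h) - -h) + -h + 1) * (2 * (-(c + h) - -h) + -h)) = _
  congr 1 <;> ring

theorem connCoeff_neg_zero : connCoeff a c g h (-1) 0 =
    2 * (c - a + h - g) * (a + c + g) / ((2 * c + h + 1) * (2 * c + h - 1)) := by
  have h1 : (-1 : SignType) ≠ 0 := by decide
  simp only [connCoeff, gaugeSign, if_true, if_neg h1]
  change -1 * 1 * 2 * ((-(a + g) - -g + (c + h) + -g) * (-(a + g) - -g - (c + h) + -g - -h)) /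
    ((2 * (c + h) + -h + 1) * (2 * (c + h) + -h - 1)) = _
  congr 1 <;> ring

theorem connCoeff_neg_one : connCoeff a c g h (-1) 1 =
    (c - a + h - g) * (c - a + h - g + 1) / ((2 * c + h + 1) * (2 * c + h)) := by
  have h1 : (1 : SignType) ≠ 0 := by decide
  have h2 : (-1 : SignType) ≠ 0 := by decide
  simp only [connCoeff, gaugeSign, if_neg h1, if_neg h2]
  change -1 * -1 * 1 * ((-(a + g) - -g + (c + h) + -g) * (-(a + g) - -g + (c + h) + -g + 1)) /
    ((2 * (c + h) + -h + 1) * (2 * (c + h) + -h)) = _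
  congr 1 <;> ring

theorem connCoeff_neg_neg : connCoeff a c g h (-1) (-1) =
    (a + c + g) * (a + c + g - 1) / ((2 * c + h - 1) * (2 * c + h)) := by
  have h2 : (-1 : SignType) ≠ 0 := by decide
  simp only [connCoeff, gaugeSign, if_neg h2]
  change -1 * -1 * 1 * ((-(a + g) - -g + (-(c + h) - -h) + -g) *
      (-(a + g) - -g + (-(c + h) - -h) + -g + 1)) /
    ((2 * (-(c + h) - -h) + -h + 1) * (2 * (-(c + h) - -h) + -h)) = _
  congr 1 <;> ring

end explicit

/-- The reciprocals of `(c)_k k!` at `k = l`, in terms of the one at `l + 1`. -/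
theorem inv_poch_mul_factorial (c : ℝ) (l : ℕ) (hc : c + l ≠ 0) :
    (poch c l * (l.factorial : ℝ))⁻¹ =
      (poch c (l + 1) * ((l + 1).factorial : ℝ))⁻¹ * ((c + l) * (l + 1)) := by
  have : (l : ℝ) + 1 ≠ 0 := by positivity
  rw [poch_succ, Nat.factorial_succ]
  push_cast
  rw [show poch c l * (c + l) * (((l : ℝ) + 1) * l.factorial) =
    (poch c l * l.factorial) * ((c + l) * (l + 1)) by ring, mul_inv (poch c l * (l.factorial : ℝ)),
    mul_assoc, inv_mul_cancel₀ (mul_ne_zero hc this), mul_one]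

theorem poch_add_two (a : ℝ) (l : ℕ) :
    poch a (l + 1 + 1) = poch a l * (a + l) * (a + l + 1) := by
  rw [poch_succ, poch_succ]
  push_cast
  ring

theorem poch_add_two_mid (a : ℝ) (l : ℕ) :
    poch a (l + 1 + 1) = a * poch (a + 1) l * (a + l + 1) := by
  rw [poch_succ, poch_succ_left]
  push_cast
  ring

theorem poch_add_two_left (a : ℝ) (l : ℕ) :
    poch a (l + 1 + 1) = a * (a + 1) * poch (a + 2) l := by
  rw [poch_succ_left, poch_succ_left, add_assoc, one_add_one_eq_two]
  ring

/-! ### Contiguity relations of `₂F₁`, coefficient by coefficient. -/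

section contiguity
variable {a c g h : ℝ}

/-- This is the coefficient of `y^k` in the relation whose left side is `(1 - y) ₂F₁`, for the shift
`s' = 0`. -/
theorem hypCoeff_contiguous_zero (hg : ∀ i : ℕ, h - g + i ≠ 0) (h0 : 2 * c + h ≠ 0)
    (h1 : 2 * c + h + 1 ≠ 0) (h2 : 2 * c + h - 1 ≠ 0) (k : ℕ) :
    hypCoeff (a - c) (a + c + h) (h - g) k -
      (if k = 0 then 0 else hypCoeff (a - c) (a + c + h) (h - g) (k - 1)) =
    connCoeff a c g h 0 (-1) * hypCoeff (a - c + 1) (a + c + h - 1) (h - g) k +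
    connCoeff a c g h 0 0 * hypCoeff (a - c) (a + c + h) (h - g) k +
    connCoeff a c g h 0 1 * hypCoeff (a - c - 1) (a + c + h + 1) (h - g) k := by
  rw [connCoeff_zero_neg, connCoeff_zero_zero, connCoeff_zero_one]
  have e0 := hg 0
  simp only [Nat.cast_zero, add_zero] at e0
  -- With `T` as a variable in place of `h`, the denominators are `T` and `T ± 1`.
  obtain ⟨T, hT⟩ : ∃ T, T = 2 * c + h := ⟨_, rfl⟩
  rw [← hT] at h0 h1 h2 ⊢
  obtain rfl : h = T - 2 * c := by rw [hT]; ring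
  -- For `k = l + 2` the Pochhammer symbols share a middle block of length `l`, and a rational
  -- identity remains once it is factored out. Orders `0` and `1` are too short for this.
  rcases k with _ | _ | l
  · simp only [hypCoeff, poch_zero, if_true, Nat.factorial_zero, Nat.cast_one, mul_one, inv_one]
    field_simp
    ring
  · simp only [hypCoeff, zero_add, poch_succ, poch_zero, one_ne_zero, if_false,
      Nat.factorial_one, Nat.sub_self, Nat.factorial_zero, Nat.cast_one, Nat.cast_zero, add_zero,
      mul_one, one_mul, inv_one]
    obtain ⟨d, hd⟩ : ∃ d, d = T - 2 * c - g := ⟨_, rfl⟩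
    rw [← hd] at e0 ⊢
    obtain rfl : g = T - 2 * c - d := by rw [hd]; ring
    field_simp
    ring
  · have e1 := inv_poch_mul_factorial (T - 2 * c - g) (l + 1) (hg (l + 1))
    rw [if_neg (by omega), show l + 1 + 1 - 1 = l + 1 from rfl]
    simp only [hypCoeff]
    rw [e1]
    generalize (poch (T - 2 * c - g) (l + 1 + 1) * ((l + 1 + 1).factorial : ℝ))⁻¹ = w
    rw [poch_add_two_left (a - c - 1), poch_add_two_mid (a - c), poch_add_two (a - c + 1),
      poch_add_two_left (a + c + (T - 2 * c) - 1), poch_add_two_mid (a + c + (T - 2 * c)),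
      poch_add_two (a + c + (T - 2 * c) + 1), poch_succ_left (a - c),
      poch_succ_left (a + c + (T - 2 * c)),
      show a - c - 1 + 2 = a - c + 1 by ring,
      show a + c + (T - 2 * c) - 1 + 2 = a + c + (T - 2 * c) + 1 by ring]
    generalize poch (a - c + 1) l = P
    generalize poch (a + c + (T - 2 * c) + 1) l = Q
    push_cast
    field_simp
    ring

/-- For `s' = 1` nothing is multiplied by `y`, so the lower parameter and `k!` enter only through a
common factor; hence `d` is arbitrary. -/
theorem hypCoeff_contiguous_one (h0 : 2 * c + h ≠ 0)
    (h1 : 2 * c + h + 1 ≠ 0) (h2 : 2 * c + h - 1 ≠ 0) (d : ℝ) (k : ℕ) :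
    hypCoeff (a - c) (a + c + h) d k =
    connCoeff a c g h 1 (-1) * hypCoeff (a - c + 2) (a + c + h) d k +
    connCoeff a c g h 1 0 * hypCoeff (a - c + 1) (a + c + h + 1) d k +
    connCoeff a c g h 1 1 * hypCoeff (a - c) (a + c + h + 2) d k := by
  rw [connCoeff_one_neg, connCoeff_one_zero, connCoeff_one_one]
  simp only [hypCoeff]
  generalize (poch d k * (k.factorial : ℝ))⁻¹ = w
  obtain ⟨T, hT⟩ : ∃ T, T = 2 * c + h := ⟨_, rfl⟩
  rw [← hT] at h0 h1 h2 ⊢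
  obtain rfl : h = T - 2 * c := by rw [hT]; ring
  rcases k with _ | _ | l
  · simp only [poch_zero]
    field_simp
    ring
  · simp only [zero_add, poch_succ, poch_zero, Nat.cast_zero, add_zero, one_mul]
    field_simp
    ring
  · rw [poch_add_two_left (a - c), poch_add_two_mid (a - c + 1), poch_add_two (a - c + 2),
      poch_add_two_left (a + c + (T - 2 * c)), poch_add_two_mid (a + c + (T - 2 * c) + 1),
      poch_add_two (a + c + (T - 2 * c) + 2), add_assoc (a - c) 1 1,
      add_assoc (a + c + (T - 2 * c)) 1 1, one_add_one_eq_two]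
    generalize poch (a - c + 2) l = P
    generalize poch (a + c + (T - 2 * c) + 2) l = Q
    field_simp
    ring

/-- For `s' = -1` the left side is `(1 - y)² ₂F₁`. -/
theorem hypCoeff_contiguous_neg (hg : ∀ i : ℕ, h - g + i ≠ 0) (h0 : 2 * c + h ≠ 0)
    (h1 : 2 * c + h + 1 ≠ 0) (h2 : 2 * c + h - 1 ≠ 0) (k : ℕ) :
    hypCoeff (a - c) (a + c + h) (h - g) k -
      2 * (if k = 0 then 0 else hypCoeff (a - c) (a + c + h) (h - g) (k - 1)) +
      (if k < 2 then 0 else hypCoeff (a - c) (a + c + h) (h - g) (k - 2)) =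
    connCoeff a c g h (-1) (-1) * hypCoeff (a - c) (a + c + h - 2) (h - g) k +
    connCoeff a c g h (-1) 0 * hypCoeff (a - c - 1) (a + c + h - 1) (h - g) k +
    connCoeff a c g h (-1) 1 * hypCoeff (a - c - 2) (a + c + h) (h - g) k := by
  rw [connCoeff_neg_neg, connCoeff_neg_zero, connCoeff_neg_one]
  have e0 := hg 0
  simp only [Nat.cast_zero, add_zero] at e0
  obtain ⟨T, hT⟩ : ∃ T, T = 2 * c + h := ⟨_, rfl⟩
  rw [← hT] at h0 h1 h2 ⊢
  obtain rfl : h = T - 2 * c := by rw [hT]; ring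
  rcases k with _ | _ | l
  · simp only [hypCoeff, poch_zero, if_true, Nat.factorial_zero, Nat.cast_one, mul_one, inv_one,
      Nat.ofNat_pos]
    field_simp
    ring
  · simp only [hypCoeff, zero_add, poch_succ, poch_zero, one_ne_zero, if_false, Nat.one_lt_ofNat,
      Nat.factorial_one, Nat.sub_self, Nat.factorial_zero, Nat.cast_one, Nat.cast_zero, add_zero,
      mul_one, one_mul, inv_one, if_true]
    obtain ⟨d, hd⟩ : ∃ d, d = T - 2 * c - g := ⟨_, rfl⟩
    rw [← hd] at e0 ⊢
    obtain rfl : g = T - 2 * c - d := by rw [hd]; ring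
    field_simp
    ring
  · have e1 := inv_poch_mul_factorial (T - 2 * c - g) (l + 1) (hg (l + 1))
    have e2 := inv_poch_mul_factorial (T - 2 * c - g) l (hg l)
    rw [if_neg (by omega), if_neg (by omega), show l + 1 + 1 - 1 = l + 1 from rfl,
      show l + 1 + 1 - 2 = l by omega]
    simp only [hypCoeff]
    rw [e2, e1]
    generalize (poch (T - 2 * c - g) (l + 1 + 1) * ((l + 1 + 1).factorial : ℝ))⁻¹ = w
    rw [poch_add_two_left (a - c - 2), poch_add_two_mid (a - c - 1), poch_add_two (a - c),
      poch_add_two_left (a + c + (T - 2 * c) - 2), poch_add_two_mid (a + c + (T - 2 * c) - 1),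
      poch_add_two (a + c + (T - 2 * c)), poch_succ (a - c),
      poch_succ (a + c + (T - 2 * c)), sub_add_cancel (a - c) 2, sub_add_cancel (a - c) 1,
      sub_add_cancel (a + c + (T - 2 * c)) 2, sub_add_cancel (a + c + (T - 2 * c)) 1]
    generalize poch (a - c) l = P
    generalize poch (a + c + (T - 2 * c)) l = Q
    push_cast
    field_simp
    ring

end contiguity

/-! ### Chu–Vandermonde and the expansion of Jacobi polynomials at `x = -1`. -/

theorem poch_add (a : ℝ) (m n : ℕ) : poch a (m + n) = poch a m * poch (a + m) n := by
  induction n with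
  | zero => simp [poch_zero]
  | succ n ih =>
    rw [← add_assoc, poch_succ, ih, poch_succ]
    push_cast
    ring

theorem poch_neg (x : ℝ) (m : ℕ) : poch (-x) m = (-1) ^ m * poch (x - m + 1) m := by
  induction m generalizing x with
  | zero => simp [poch_zero]
  | succ m ih =>
    rw [poch_succ_left, show -x + 1 = -(x - 1) by ring, ih, poch_succ]
    push_cast
    rw [show x - 1 - (m : ℝ) + 1 = x - (m + 1) + 1 by ring]
    ring

theorem poch_one (m : ℕ) : poch 1 m = m.factorial := by
  induction m with
  | zero => simp [poch_zero]
  | succ m ih =>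
    rw [poch_succ, ih, Nat.factorial_succ]
    push_cast
    ring

theorem poch_neg_natCast (n k : ℕ) (hk : k ≤ n) :
    poch (-(n : ℝ)) k = (-1) ^ k * k.factorial * n.choose k := by
  have h1 : (n.factorial : ℝ) = (n - k).factorial * poch ((n : ℝ) - k + 1) k := by
    rw [← poch_one, ← poch_one]
    conv_lhs => rw [← Nat.sub_add_cancel hk]
    rw [poch_add, Nat.cast_sub hk, add_comm (1 : ℝ)]
  have h2 : ((n.choose k * k.factorial * (n - k).factorial : ℕ) : ℝ) = n.factorial := by
    rw [Nat.choose_mul_factorial_mul_factorial hk]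
  have h3 : ((n - k).factorial : ℝ) ≠ 0 := by positivity
  push_cast at h2
  rw [poch_neg]
  have : poch ((n : ℝ) - k + 1) k = k.factorial * n.choose k := by
    apply mul_left_cancel₀ h3
    rw [← h1, ← h2]
    ring
  rw [this, mul_assoc]

theorem poch_neg_natCast_eq_zero (n k : ℕ) (hk : n < k) : poch (-(n : ℝ)) k = 0 := by
  unfold poch
  exact Finset.prod_eq_zero (Finset.mem_range.mpr hk) (by simp)

theorem poch_ne_zero {a : ℝ} (ha : ∀ i : ℕ, a + i ≠ 0) (n : ℕ) : poch a n ≠ 0 :=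
  Finset.prod_ne_zero_iff.mpr fun i _ => ha i

/-- The Chu–Vandermonde identity. -/
theorem sum_choose_mul_poch (n : ℕ) (b c : ℝ) :
    ∑ i ∈ Finset.range (n + 1), (-1) ^ i * (n.choose i : ℝ) * poch b i * poch (c + i) (n - i) =
      poch (c - b) n := by
  induction n generalizing b c with
  | zero => simp [poch_zero]
  | succ n ih =>
    -- Pascal's rule: the `n.choose i` part yields the factor `c + n` from the end of
    -- `(c+i)_{n+1-i}`, the other part is the same sum with `b` and `c` raised by one.
    have key : ∑ i ∈ Finset.range (n + 1 + 1),
        (-1) ^ i * ((n + 1).choose i : ℝ) * poch b i * poch (c + i) (n + 1 - i) =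
      (c + n) * (∑ i ∈ Finset.range (n + 1),
        (-1) ^ i * (n.choose i : ℝ) * poch b i * poch (c + i) (n - i)) -
      b * (∑ i ∈ Finset.range (n + 1),
        (-1) ^ i * (n.choose i : ℝ) * poch (b + 1) i * poch (c + 1 + i) (n - i)) := by
      rw [Finset.sum_range_succ']
      have e1 : ∀ i ∈ Finset.range (n + 1),
          (-1 : ℝ) ^ (i + 1) * ((n + 1).choose (i + 1) : ℝ) * poch b (i + 1) *
            poch (c + ((i + 1 : ℕ) : ℝ)) (n + 1 - (i + 1)) =
          (-1 : ℝ) ^ (i + 1) * (n.choose (i + 1) : ℝ) * poch b (i + 1) *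
            poch (c + ((i + 1 : ℕ) : ℝ)) (n + 1 - (i + 1)) -
          b * ((-1) ^ i * (n.choose i : ℝ) * poch (b + 1) i * poch (c + 1 + i) (n - i)) := by
        intro i _
        rw [Nat.choose_succ_succ, poch_succ_left, Nat.add_sub_add_right,
          show c + ((i + 1 : ℕ) : ℝ) = c + 1 + i by push_cast; ring]
        push_cast
        ring
      rw [Finset.sum_congr rfl e1, Finset.sum_sub_distrib, ← Finset.mul_sum, sub_add_eq_add_sub]
      congr 1
      have e2 := Finset.sum_range_succ' (fun i => (-1 : ℝ) ^ i * (n.choose i : ℝ) * poch b i *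
            poch (c + (i : ℝ)) (n + 1 - i)) (n + 1)
      rw [Nat.choose_zero_right] at e2 ⊢
      rw [← e2, Finset.sum_range_succ, Nat.choose_succ_self, Nat.cast_zero, mul_zero, zero_mul,
        zero_mul, add_zero, Finset.mul_sum]
      refine Finset.sum_congr rfl fun i hi => ?_
      have hi' : i ≤ n := Nat.lt_succ_iff.mp (Finset.mem_range.mp hi)
      rw [Nat.succ_sub hi', Nat.succ_eq_add_one, poch_succ, Nat.cast_sub hi']
      ring
    rw [key, ih, ih, poch_succ]
    rw [show c + 1 - (b + 1) = c - b by ring]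
    ring

theorem jacobiCoeff_eq (n : ℕ) (α β : ℝ) (i : ℕ) (hi : i ≤ n) :
    jacobiCoeff n α β i = (-1) ^ i * (n.choose i : ℝ) * poch (n + α + β + 1) i *
      poch (α + 1 + i) (n - i) / n.factorial := by
  unfold jacobiCoeff
  rw [poch_neg_natCast n i hi]
  have : (i.factorial : ℝ) ≠ 0 := by positivity
  have : (n.factorial : ℝ) ≠ 0 := by positivity
  field_simp

/-- The Taylor coefficients of a Jacobi polynomial at `x = -1`. -/
theorem sum_choose_mul_jacobiCoeff (n : ℕ) (α β : ℝ) (hβ : ∀ i : ℕ, β + 1 + i ≠ 0) (k : ℕ)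
    (hk : k ≤ n) :
    (-1) ^ n * (n.factorial / poch (β + 1) n) *
      ∑ i ∈ Finset.range (n + 1), (i.choose k : ℝ) * (-1) ^ k * jacobiCoeff n α β i =
    hypCoeff (-n) (n + α + β + 1) (β + 1) k := by
  -- Only `i = k + l` contributes, and `C(n, k+l) C(k+l, k) = C(n, k) C(n-k, l)` turns the rest into
  -- a Chu–Vandermonde sum.
  have e1 : ∑ i ∈ Finset.range (n + 1), (i.choose k : ℝ) * (-1) ^ k * jacobiCoeff n α β i =
      (n.choose k : ℝ) * poch (n + α + β + 1) k / n.factorial *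
        poch (α + 1 + k - (n + α + β + 1 + k)) (n - k) := by
    rw [← sum_choose_mul_poch, Finset.mul_sum]
    rw [Finset.range_eq_Ico, ← Finset.sum_Ico_consecutive _ (Nat.zero_le k) (by omega : k ≤ n + 1)]
    rw [Finset.sum_eq_zero, zero_add, Finset.sum_Ico_eq_sum_range,
      show n + 1 - k = n - k + 1 by omega]
    · refine Finset.sum_congr rfl fun l hl => ?_
      have hl' : l ≤ n - k := Nat.lt_succ_iff.mp (Finset.mem_range.mp hl)
      have hc : ((n.choose (k + l) * (k + l).choose k : ℕ) : ℝ) =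
          ((n.choose k * (n - k).choose l : ℕ) : ℝ) := by
        rw [Nat.choose_mul (Nat.le_add_right k l), Nat.add_sub_cancel_left]
      push_cast at hc
      rw [jacobiCoeff_eq n α β (k + l) (by omega), poch_add, Nat.sub_add_eq]
      push_cast
      rw [show (-1 : ℝ) ^ (k + l) = (-1) ^ k * (-1) ^ l from pow_add _ _ _,
        show α + 1 + ((k : ℝ) + l) = α + 1 + k + l by ring]
      have hs : ((-1 : ℝ) ^ k) * (-1) ^ k = 1 := by rw [← mul_pow]; simp
      linear_combination (((-1 : ℝ) ^ k) * (-1) ^ k * (-1) ^ l * poch (n + α + β + 1) k *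
        poch (n + α + β + 1 + k) l * poch (α + 1 + k + l) (n - k - l) / n.factorial) * hc +
        ((-1) ^ l * poch (n + α + β + 1) k *
        poch (n + α + β + 1 + k) l * poch (α + 1 + k + l) (n - k - l) / n.factorial *
        (n.choose k * (n - k).choose l)) * hs
    · intro i hi
      rw [Nat.choose_eq_zero_of_lt (Finset.mem_Ico.mp hi).2]
      simp
  rw [e1, show α + 1 + k - (n + α + β + 1 + k) = -((n : ℝ) + β) by ring, poch_neg,
    Nat.cast_sub hk, show (n : ℝ) + β - (n - k) + 1 = β + 1 + k by ring, hypCoeff,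
    poch_neg_natCast n k hk]
  have e2 : poch (β + 1) n = poch (β + 1) k * poch (β + 1 + k) (n - k) := by
    rw [← poch_add, Nat.add_sub_cancel' hk]
  have h1 : poch (β + 1) k ≠ 0 := poch_ne_zero hβ k
  have h2 : poch (β + 1 + k) (n - k) ≠ 0 := fun h => poch_ne_zero hβ n (by rw [e2, h, mul_zero])
  have h3 : (k.factorial : ℝ) ≠ 0 := by positivity
  have h4 : (n.factorial : ℝ) ≠ 0 := by positivity
  have h5 : (-1 : ℝ) ^ n * (-1) ^ (n - k) = (-1) ^ k := by
    rw [← pow_add, show n + (n - k) = k + 2 * (n - k) by omega, pow_add, pow_mul]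
    simp
  rw [e2, ← h5]
  field_simp

/-! ### Homogenized polynomials. -/

section homogeneous
variable {σ : Type*}

/-- The homogenization `∑_{k ≤ N} e_k y^k v^(N-k)` of the polynomial with coefficients `e`. -/
noncomputable def homSum (N : ℕ) (e : ℕ → ℝ) (y v : MvPolynomial σ ℝ) : MvPolynomial σ ℝ :=
  ∑ k ∈ Finset.range (N + 1), MvPolynomial.C (e k) * y ^ k * v ^ (N - k)

theorem homSum_congr {N : ℕ} {e f : ℕ → ℝ} (y v : MvPolynomial σ ℝ) (h : ∀ k ≤ N, e k = f k) :
    homSum N e y v = homSum N f y v :=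
  Finset.sum_congr rfl fun k hk => by rw [h k (Nat.lt_succ_iff.mp (Finset.mem_range.mp hk))]

theorem C_mul_homSum (N : ℕ) (x : ℝ) (e : ℕ → ℝ) (y v : MvPolynomial σ ℝ) :
    MvPolynomial.C x * homSum N e y v = homSum N (fun k => x * e k) y v := by
  unfold homSum
  rw [Finset.mul_sum]
  exact Finset.sum_congr rfl fun k _ => by rw [map_mul]; ring

theorem homSum_add (N : ℕ) (e f : ℕ → ℝ) (y v : MvPolynomial σ ℝ) :
    homSum N e y v + homSum N f y v = homSum N (fun k => e k + f k) y v := by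
  unfold homSum
  rw [← Finset.sum_add_distrib]
  exact Finset.sum_congr rfl fun k _ => by rw [map_add]; ring

theorem mul_homSum_of_eq_zero (N : ℕ) (e : ℕ → ℝ) (y v : MvPolynomial σ ℝ) (h : e (N + 1) = 0) :
    v * homSum N e y v = homSum (N + 1) e y v := by
  unfold homSum
  rw [Finset.sum_range_succ _ (N + 1), h, map_zero, zero_mul, zero_mul, add_zero, Finset.mul_sum]
  refine Finset.sum_congr rfl fun k hk => ?_
  rw [Nat.succ_sub (Nat.lt_succ_iff.mp (Finset.mem_range.mp hk)), pow_succ]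
  ring

/-- Appending vanishing coefficients raises the degree of homogenization, so all terms of a
contiguity relation can be compared in one common degree. -/
theorem pow_mul_homSum (m N : ℕ) (e : ℕ → ℝ) (y v : MvPolynomial σ ℝ)
    (h : ∀ k, N < k → e k = 0) :
    v ^ m * homSum N e y v = homSum (N + m) e y v := by
  induction m with
  | zero => simp
  | succ m ih =>
    rw [pow_succ', mul_assoc, ih, mul_homSum_of_eq_zero _ _ _ _ (h _ (by omega)), add_assoc]

theorem mul_homSum_left (N : ℕ) (e : ℕ → ℝ) (y v : MvPolynomial σ ℝ) :
    y * homSum N e y v = homSum (N + 1) (fun k => if k = 0 then 0 else e (k - 1)) y v := by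
  unfold homSum
  rw [Finset.sum_range_succ' _ (N + 1)]
  beta_reduce
  rw [if_pos rfl, map_zero, zero_mul, zero_mul, add_zero, Finset.mul_sum]
  refine Finset.sum_congr rfl fun k _ => ?_
  rw [if_neg (Nat.succ_ne_zero k), Nat.add_sub_cancel, Nat.add_sub_add_right, pow_succ]
  ring

theorem hypCoeff_neg_natCast_eq_zero (n : ℕ) (b c : ℝ) (k : ℕ) (hk : n < k) :
    hypCoeff (-(n : ℝ)) b c k = 0 := by
  rw [hypCoeff, poch_neg_natCast_eq_zero n k hk, zero_mul, zero_mul]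

end homogeneous

/-- Passage from powers of `u` (expansion at `x = 1`) to powers of `v - u` (expansion at `x = -1`),
by the binomial theorem; the normalization of `J_p` is the one that makes the constant coefficient
`1`. -/
theorem jacobiHom_eq_homSum {p : ℕ} (n : ℕ) (α β : ℝ) (hβ : ∀ i : ℕ, β + 1 + i ≠ 0)
    (u v : MvPolynomial (Fin p) ℝ) :
    MvPolynomial.C ((-1) ^ n * (n.factorial / poch (β + 1) n)) * jacobiHom n α β u v =
      homSum n (hypCoeff (-n) (n + α + β + 1) (β + 1)) (v - u) v := by
  have hu : u = -(v - u) + v := by ring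
  generalize v - u = y at hu ⊢
  subst hu
  unfold jacobiHom
  have e1 : ∀ i ∈ Finset.range (n + 1),
      MvPolynomial.C (jacobiCoeff n α β i) * (-y + v) ^ i * v ^ (n - i) =
      ∑ k ∈ Finset.range (n + 1), MvPolynomial.C ((i.choose k : ℝ) * (-1) ^ k *
        jacobiCoeff n α β i) * y ^ k * v ^ (n - k) := by
    intro i hi
    have hi' : i ≤ n := Nat.lt_succ_iff.mp (Finset.mem_range.mp hi)
    rw [add_pow, Finset.mul_sum, Finset.sum_mul]
    have hsub : Finset.range (i + 1) ⊆ Finset.range (n + 1) :=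
      Finset.range_subset_range.mpr (by omega)
    rw [← Finset.sum_subset hsub]
    · refine Finset.sum_congr rfl fun k hk => ?_
      have hk' : k ≤ i := Nat.lt_succ_iff.mp (Finset.mem_range.mp hk)
      rw [show n - k = (i - k) + (n - i) by omega, pow_add, neg_pow]
      simp only [map_mul, map_pow, map_neg, map_one, map_natCast]
      ring
    · intro k _ hk
      rw [Nat.choose_eq_zero_of_lt (by simpa using hk)]
      simp
  rw [Finset.sum_congr rfl e1, Finset.sum_comm, Finset.mul_sum]
  refine Finset.sum_congr rfl fun k hk => ?_
  have hk' : k ≤ n := Nat.lt_succ_iff.mp (Finset.mem_range.mp hk)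
  rw [← sum_choose_mul_jacobiCoeff n α β hβ k hk', map_mul MvPolynomial.C (_ * _) (Finset.sum _ _),
    map_sum, Finset.mul_sum, Finset.mul_sum, Finset.sum_mul, Finset.sum_mul]
  exact Finset.sum_congr rfl fun i _ => by ring

/-! ### Contiguity relations of the Jacobi factors, regularized at `c = 0`. -/

section factor
variable {σ : Type*} (g h : ℝ)

/-- The normalized homogeneous Jacobi polynomial of degree `c - a`, as a function of the partial
sums `a` and `c` of the indices; `y = v - u`. It is `0` if `c < a`. -/
noncomputable def jacobiFactor (a c : ℤ) (y v : MvPolynomial σ ℝ) : MvPolynomial σ ℝ :=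
  if a ≤ c then homSum (c - a).toNat (hypCoeff (a - c) (a + c + h) (h - g)) y v else 0

/-- `connCoeff` with the removable singularities at `c = 0` removed, and with the value `0` when the
shifted degree is negative. -/
noncomputable def regConnCoeff (a c : ℤ) (s' s : SignType) : ℝ :=
  if c + s < a + s' then 0
  else if c = 0 then
    if s = 0 then (g + 1) / (h + 1) else if s' = 0 then (h - g) / (h + 1) else 1
  else connCoeff a c g h s' s

variable {g h}

theorem hypCoeff_eq_zero_of_int {a c : ℤ} (hac : a ≤ c) (b d : ℝ) (k : ℕ)
    (hk : (c - a).toNat < k) : hypCoeff ((a : ℝ) - c) b d k = 0 := by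
  have : ((a : ℝ) - c) = -(((c - a).toNat : ℕ) : ℝ) := by
    have h1 : (((c - a).toNat : ℤ) : ℝ) = ((c - a : ℤ) : ℝ) := by
      rw [Int.toNat_of_nonneg (by omega)]
    rw [Int.cast_natCast] at h1
    rw [h1]
    push_cast
    ring
  rw [this]
  exact hypCoeff_neg_natCast_eq_zero _ _ _ _ hk

theorem pow_mul_jacobiFactor {a c : ℤ} (hac : a ≤ c) (m : ℕ) (y v : MvPolynomial σ ℝ) :
    v ^ m * jacobiFactor g h a c y v =
      homSum ((c - a).toNat + m) (hypCoeff (a - c) (a + c + h) (h - g)) y v := by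
  rw [jacobiFactor, if_pos hac]
  exact pow_mul_homSum _ _ _ _ _ fun k hk => hypCoeff_eq_zero_of_int hac _ _ k hk

/-- Puts every term of a contiguity relation in the same form. If `c < a` the factor is `0` by
convention but the sum on the right need not be, which is why `x` must vanish then. -/
theorem C_mul_pow_mul_jacobiFactor {a c : ℤ} (m N : ℕ) (hN : (N : ℤ) = c - a + m) (x A b : ℝ)
    (hx : c < a → x = 0) (hA : A = a - c) (hb : b = a + c + h) (y v : MvPolynomial σ ℝ) :
    MvPolynomial.C x * (v ^ m * jacobiFactor g h a c y v) =
      homSum N (fun k => x * hypCoeff A b (h - g) k) y v := by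
  subst hA hb
  by_cases hac : a ≤ c
  · rw [pow_mul_jacobiFactor hac, C_mul_homSum]
    congr 1
    omega
  · rw [hx (by omega)]
    simp [homSum]

/-- The contiguity relations of the Jacobi polynomials. -/
theorem jacobiFactor_contiguous (hg : ∀ i : ℕ, h - g + i ≠ 0) {a c : ℤ} (hac : a ≤ c)
    (h0 : 2 * (c : ℝ) + h ≠ 0) (h1 : 2 * (c : ℝ) + h + 1 ≠ 0) (h2 : 2 * (c : ℝ) + h - 1 ≠ 0)
    (s' : SignType) (u v : MvPolynomial σ ℝ) :
    u ^ (1 - (s' : ℤ)).toNat * jacobiFactor g h a c (v - u) v =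
      ∑ s : SignType, MvPolynomial.C (connCoeff a c g h s' s) *
        (v ^ (1 - (s : ℤ)).toNat * jacobiFactor g h (a + s') (c + s) (v - u) v) := by
  obtain ⟨n, hn⟩ : ∃ n : ℕ, c = a + n := ⟨(c - a).toNat, by omega⟩
  obtain ⟨y, hy⟩ : ∃ y, y = v - u := ⟨_, rfl⟩
  have hu : u = v - y := by rw [hy]; ring
  rw [← hy, hu]
  have hF : ∀ m N : ℕ, N = n + m → v ^ m * jacobiFactor g h a c y v =
      homSum N (hypCoeff (a - c) (a + c + h) (h - g)) y v := by
    intro m N hN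
    rw [pow_mul_jacobiFactor hac, hN]
    congr 2
    omega
  have hF0 := hF 0 n rfl
  rw [pow_zero, one_mul] at hF0
  rw [sum_signType]
  rcases s' with _ | _ | _
  · simp only [SignType.zero_eq_zero, SignType.coe_zero, SignType.coe_neg_one, SignType.coe_one]
    rw [C_mul_pow_mul_jacobiFactor _ (n + 1) (by simp; omega) _ (a - c + 1) (a + c + h - 1) _
        (by push_cast; ring) (by push_cast; ring),
      C_mul_pow_mul_jacobiFactor _ (n + 1) (by simp; omega) _ (a - c) (a + c + h) _
        (by push_cast; ring) (by push_cast; ring),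
      C_mul_pow_mul_jacobiFactor _ (n + 1) (by simp; omega) _ (a - c - 1) (a + c + h + 1) _
        (by push_cast; ring) (by push_cast; ring), homSum_add, homSum_add]
    · have e : (v - y) ^ (1 - (0 : ℤ)).toNat * jacobiFactor g h a c y v =
          v ^ 1 * jacobiFactor g h a c y v +
            MvPolynomial.C (-1) * (y * jacobiFactor g h a c y v) := by
        simp
        ring
      rw [e, hF 1 (n + 1) rfl, hF0, mul_homSum_left, C_mul_homSum, homSum_add]
      refine homSum_congr _ _ fun k _ => ?_
      rw [← hypCoeff_contiguous_zero hg h0 h1 h2]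
      ring
    · omega
    · omega
    -- Here `c - 1 < a ≤ c`, so `c = a` and the factor `c - a` of the coefficient vanishes.
    · intro hlt
      rw [connCoeff_zero_neg, show (c : ℝ) - a = 0 by rw [show c = a by omega]; ring]
      simp
  · simp only [SignType.neg_eq_neg_one, SignType.coe_zero, SignType.coe_neg_one, SignType.coe_one]
    rw [C_mul_pow_mul_jacobiFactor _ (n + 2) (by simp; omega) _ (a - c) (a + c + h - 2) _
        (by push_cast; ring) (by push_cast; ring),
      C_mul_pow_mul_jacobiFactor _ (n + 2) (by simp; omega) _ (a - c - 1) (a + c + h - 1) _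
        (by push_cast; ring) (by push_cast; ring),
      C_mul_pow_mul_jacobiFactor _ (n + 2) (by simp; omega) _ (a - c - 2) (a + c + h) _
        (by push_cast; ring) (by push_cast; ring), homSum_add, homSum_add]
    · have e : (v - y) ^ (1 - (-1 : ℤ)).toNat * jacobiFactor g h a c y v =
          v ^ 2 * jacobiFactor g h a c y v +
            MvPolynomial.C (-2) * (y * (v ^ 1 * jacobiFactor g h a c y v)) +
              y * (y * jacobiFactor g h a c y v) := by
        rw [map_neg, map_ofNat, show (1 - (-1 : ℤ)).toNat = 2 from rfl]
        ring
      rw [e, hF 2 (n + 2) rfl, hF 1 (n + 1) rfl, hF0, mul_homSum_left, mul_homSum_left,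
        mul_homSum_left, C_mul_homSum, homSum_add, homSum_add]
      refine homSum_congr _ _ fun k _ => ?_
      rw [← hypCoeff_contiguous_neg hg h0 h1 h2]
      rcases k with _ | _ | k
      · simp
      · simp
        ring
      · simp
        ring
    · omega
    · omega
    · omega
  · simp only [SignType.pos_eq_one, SignType.coe_zero, SignType.coe_neg_one, SignType.coe_one]
    rw [C_mul_pow_mul_jacobiFactor _ n (by simp; omega) _ (a - c + 2) (a + c + h) _
        (by push_cast; ring) (by push_cast; ring),
      C_mul_pow_mul_jacobiFactor _ n (by simp; omega) _ (a - c + 1) (a + c + h + 1) _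
        (by push_cast; ring) (by push_cast; ring),
      C_mul_pow_mul_jacobiFactor _ n (by simp; omega) _ (a - c) (a + c + h + 2) _
        (by push_cast; ring) (by push_cast; ring), homSum_add, homSum_add]
    · simp only [sub_self, Int.toNat_zero, pow_zero, one_mul]
      rw [hF0]
      exact homSum_congr _ _ fun k _ => hypCoeff_contiguous_one h0 h1 h2 _ _
    · omega
    · intro hlt
      rw [connCoeff_one_zero, show (c : ℝ) - a = 0 by rw [show c = a by omega]; ring]
      simp
    · intro hlt
      rw [connCoeff_one_neg]
      obtain h | h : c = a ∨ c = a + 1 := by omega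
      · rw [h]; simp
      · rw [h]; simp

/-- Outside the admissible indices the connection coefficients vanish. -/
theorem connCoeff_eq_zero_of_lt {a c : ℤ} (hac : a ≤ c) {s' s : SignType} (hlt : c + s < a + s') :
    connCoeff a c g h s' s = 0 := by
  rcases s' with _ | _ | _ <;> rcases s with _ | _ | _ <;>
    simp only [SignType.zero_eq_zero, SignType.neg_eq_neg_one, SignType.pos_eq_one,
      SignType.coe_zero, SignType.coe_neg_one, SignType.coe_one] at hlt ⊢ <;>
    try omega
  · rw [connCoeff_zero_neg, show (c : ℝ) - a = 0 by rw [show c = a by omega]; ring]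
    simp
  · rw [connCoeff_one_zero, show (c : ℝ) - a = 0 by rw [show c = a by omega]; ring]
    simp
  · rw [connCoeff_one_neg]
    obtain h | h : c = a ∨ c = a + 1 := by omega
    · rw [h]; simp
    · rw [h]; simp

/-- The regularized coefficients agree with the original ones for generic parameters. -/
theorem regConnCoeff_eq_connCoeff {a c : ℤ} (ha : 0 ≤ a) (hac : a ≤ c)
    (hgen : ∀ ε : SignType, 2 * (c : ℝ) + h + ε ≠ 0) {s' s : SignType}
    (hs' : 0 ≤ a + s') :
    regConnCoeff g h a c s' s = connCoeff a c g h s' s := by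
  unfold regConnCoeff
  split_ifs with h1 h2 h3 h4
  · exact (connCoeff_eq_zero_of_lt hac h1).symm
  all_goals
    have h0 := hgen 0
    have hp := hgen 1
    have hm := hgen (-1)
    simp only [SignType.coe_zero, SignType.coe_one, SignType.coe_neg_one, add_zero,
      ← sub_eq_add_neg] at h0 hp hm
  · subst h2 h3
    obtain rfl : a = 0 := by omega
    obtain rfl : s' = 0 := by
      rcases s' with _ | _ | _
      · rfl
      · simp at hs'
      · simp at h1
    rw [connCoeff_zero_zero]
    simp only [Int.cast_zero, mul_zero, zero_add] at *
    field_simp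
    ring
  · subst h2 h4
    obtain rfl : a = 0 := by omega
    obtain rfl : s = 1 := by
      rcases s with _ | _ | _
      · simp at h3
      · simp at h1
      · rfl
    rw [connCoeff_zero_one]
    simp only [Int.cast_zero, mul_zero, zero_add] at *
    field_simp
    ring
  · subst h2
    obtain rfl : a = 0 := by omega
    obtain rfl : s' = 1 := by
      rcases s' with _ | _ | _
      · simp at h4
      · simp at hs'
      · rfl
    obtain rfl : s = 1 := by
      rcases s with _ | _ | _
      · simp at h3
      · simp at h1
      · rfl
    rw [connCoeff_one_one]
    simp only [Int.cast_zero, mul_zero, zero_add] at *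
    field_simp
  · rfl

theorem regConnCoeff_eq_zero_of_lt {a c : ℤ} {s' s : SignType} (hlt : c + s < a + s') :
    regConnCoeff g h a c s' s = 0 := if_pos hlt

theorem jacobiFactor_contiguous_reg (hg : ∀ i : ℕ, h - g + i ≠ 0) {a c : ℤ} (ha : 0 ≤ a)
    (hac : a ≤ c) (hc0 : c = 0 → h + 1 ≠ 0)
    (hc : c ≠ 0 → ∀ ε : SignType, 2 * (c : ℝ) + h + ε ≠ 0)
    {s' : SignType} (hs' : 0 ≤ a + s') (u v : MvPolynomial σ ℝ) :
    u ^ (1 - (s' : ℤ)).toNat * jacobiFactor g h a c (v - u) v =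
      ∑ s : SignType, MvPolynomial.C (regConnCoeff g h a c s' s) *
        (v ^ (1 - (s : ℤ)).toNat * jacobiFactor g h (a + s') (c + s) (v - u) v) := by
  -- At `c = 0` the inequalities leave `a = 0` and `s' ∈ {0, 1}`; all factors have degree at most
  -- one and are expanded.
  by_cases h00 : c = 0
  · subst h00
    obtain rfl : a = 0 := by omega
    have hh := hc0 rfl
    have hd := hg 0
    simp only [Nat.cast_zero, add_zero] at hd
    rw [sum_signType]
    rcases s' with _ | _ | _
    · simp only [SignType.zero_eq_zero, SignType.coe_zero, SignType.coe_neg_one, SignType.coe_one]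
      rw [regConnCoeff_eq_zero_of_lt (by simp)]
      simp [regConnCoeff, jacobiFactor, homSum, Finset.sum_range_succ, hypCoeff, poch_succ,
        poch_zero]
      have e : (1 + h) * (h - g)⁻¹ * ((h - g) / (h + 1)) = 1 := by field_simp; ring
      have e' : (MvPolynomial.C (1 + h) * MvPolynomial.C (h - g)⁻¹ *
          MvPolynomial.C ((h - g) / (h + 1)) : MvPolynomial σ ℝ) = 1 := by
        rw [← map_mul, ← map_mul, e, map_one]
      have e2 : (g + 1) / (h + 1) + (h - g) / (h + 1) = 1 := by field_simp; ring
      have e2' : (MvPolynomial.C ((g + 1) / (h + 1)) +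
          MvPolynomial.C ((h - g) / (h + 1)) : MvPolynomial σ ℝ) = 1 := by
        rw [← map_add, e2, map_one]
      simp only [map_add, map_one] at e' e2' ⊢
      linear_combination (v - u) * e' - v * e2'
    · simp at hs'
    · simp only [SignType.pos_eq_one, SignType.coe_zero, SignType.coe_neg_one, SignType.coe_one]
      rw [regConnCoeff_eq_zero_of_lt (by simp), regConnCoeff_eq_zero_of_lt (by simp)]
      simp [regConnCoeff, jacobiFactor, homSum, hypCoeff, poch_zero]
  · rw [jacobiFactor_contiguous hg hac]
    · refine Finset.sum_congr rfl fun s _ => ?_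
      rw [regConnCoeff_eq_connCoeff ha hac (hc h00) hs']
    · simpa using hc h00 0
    · simpa using hc h00 1
    · simpa [← sub_eq_add_neg] using hc h00 (-1)

end factor

/-! ### Partial sums. -/

section psum

theorem psum_zero {R : Type*} [AddCommMonoid R] {m : ℕ} (v : Fin m → R) : psum v 0 = 0 := by
  simp [psum]

theorem psum_succ {R : Type*} [AddCommMonoid R] {m : ℕ} (v : Fin m → R) {k : ℕ} (hk : k < m) :
    psum v (k + 1) = psum v k + v ⟨k, hk⟩ := by
  unfold psum
  have : ∀ i : Fin m, (if (i : ℕ) < k + 1 then v i else 0) =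
      (if (i : ℕ) < k then v i else 0) + if i = ⟨k, hk⟩ then v i else 0 := by
    intro i
    rcases lt_trichotomy (i : ℕ) k with h | h | h
    · have : i ≠ ⟨k, hk⟩ := fun e => by simp [e] at h
      simp [h, this, Nat.lt_succ_of_lt h]
    · have : i = ⟨k, hk⟩ := Fin.ext h
      subst this
      simp
    · have : i ≠ ⟨k, hk⟩ := fun e => by simp [e] at h
      simp [this, not_lt.mpr h.le, not_lt.mpr (Nat.succ_le_of_lt h)]
  rw [Finset.sum_congr rfl fun i _ => this i, Finset.sum_add_distrib]
  simp

theorem psum_mono {m : ℕ} (v : Fin m → ℕ) {k l : ℕ} (h : k ≤ l) : psum v k ≤ psum v l := by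
  unfold psum
  refine Finset.sum_le_sum fun i _ => ?_
  split_ifs <;> omega

end psum

/-! ### The transfer matrix method. -/

section transfer

/-- The tuple `ν` followed by the constant `e`. -/
def extend {S : Type*} {j : ℕ} (ν : Fin j → S) (e : S) (k : ℕ) : S :=
  if h : k < j then ν ⟨k, h⟩ else e

theorem extend_snoc_of_le {S : Type*} {j : ℕ} (ν : Fin j → S) (s e : S) {k : ℕ} (hk : k ≤ j) :
    extend (Fin.snoc ν s : Fin (j + 1) → S) e k = extend ν s k := by
  unfold extend
  rw [dif_pos (by omega)]
  split_ifs with h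
  · rw [show (⟨k, Nat.lt_succ_of_le hk⟩ : Fin (j + 1)) = Fin.castSucc ⟨k, h⟩ from rfl]
    exact Fin.snoc_castSucc (α := fun _ => S) _ _ _
  · obtain rfl : k = j := by omega
    exact Fin.snoc_last (α := fun _ => S) _ _

theorem extend_self {S : Type*} {j : ℕ} (ν : Fin j → S) (e : S) : extend ν e j = e :=
  dif_neg (lt_irrefl j)

/-- The transfer matrix method: local relations `X k * u (k+1) s' = ∑ s, W k s' s * u k s` give the
expansion of `(∏ X k) * u j e` as a sum over paths ending at `e`. The relations are only
needed at states that are reached with nonzero weight. -/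
theorem prod_mul_eq_sum_paths {R S : Type*} [CommSemiring R] [Fintype S] (W : ℕ → S → S → R)
    (u : ℕ → S → R) (X : ℕ → R) (good : ℕ → S → Prop) (j : ℕ)
    (hrel : ∀ k < j, ∀ s', good (k + 1) s' → X k * u (k + 1) s' = ∑ s, W k s' s * u k s)
    (hbad : ∀ k < j, ∀ s' s, good (k + 1) s' → ¬ good k s → W k s' s = 0)
    (e : S) (he : good j e) :
    (∏ k ∈ Finset.range j, X k) * u j e =
      ∑ ν : Fin j → S, (∏ k ∈ Finset.range j, W k (extend ν e (k + 1)) (extend ν e k)) *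
        u 0 (extend ν e 0) := by
  induction j generalizing e with
  | zero => simp [extend]
  | succ j ih =>
    rw [Finset.prod_range_succ, mul_assoc, hrel j (Nat.lt_succ_self j) e he, Finset.mul_sum]
    rw [← Fintype.sum_equiv (Fin.snocEquiv fun _ : Fin (j + 1) => S) _ _ fun _ => rfl,
      Fintype.sum_prod_type]
    refine Finset.sum_congr rfl fun s _ => ?_
    have key : ∀ ν : Fin j → S,
        (∏ k ∈ Finset.range (j + 1), W k
          (extend (Fin.snoc ν s : Fin (j + 1) → S) e (k + 1))
          (extend (Fin.snoc ν s : Fin (j + 1) → S) e k)) *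
        u 0 (extend (Fin.snoc ν s : Fin (j + 1) → S) e 0) =
        W j e s * ((∏ k ∈ Finset.range j, W k (extend ν s (k + 1)) (extend ν s k)) *
          u 0 (extend ν s 0)) := by
      intro ν
      rw [Finset.prod_range_succ, extend_self, extend_snoc_of_le _ _ _ le_rfl,
        extend_snoc_of_le _ _ _ (Nat.zero_le j), extend_self,
        mul_comm (Finset.prod _ _) (W j e s), mul_assoc]
      congr 2
      refine Finset.prod_congr rfl fun k hk => ?_
      have := Finset.mem_range.mp hk
      rw [extend_snoc_of_le _ _ _ (by omega), extend_snoc_of_le _ _ _ (by omega)]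
    change _ = ∑ ν : Fin j → S, (∏ k ∈ Finset.range (j + 1), W k
          (extend (Fin.snoc ν s : Fin (j + 1) → S) e (k + 1))
          (extend (Fin.snoc ν s : Fin (j + 1) → S) e k)) *
        u 0 (extend (Fin.snoc ν s : Fin (j + 1) → S) e 0)
    rw [Finset.sum_congr rfl fun ν _ => key ν, ← Finset.mul_sum]
    by_cases hs : good j s
    · rw [← ih (fun k hk => hrel k (by omega)) (fun k hk => hbad k (by omega)) s hs]
      ring
    · rw [hbad j (Nat.lt_succ_self j) e s he hs]
      simp

theorem entry_succ {j : ℕ} (ν : Fin j → SignType) (k : ℕ) : entry ν (k + 1) = extend ν 0 k := by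
  unfold entry extend
  by_cases h : k < j
  · rw [dif_pos ⟨by omega, by omega⟩, dif_pos h]
    rfl
  · rw [dif_neg (by omega), dif_neg h]

theorem entry_of_lt {j : ℕ} (ν : Fin j → SignType) {k : ℕ} (hk : j < k) : entry ν k = 0 :=
  dif_neg (by omega)

end transfer

/-! ### Factorization of the simplex polynomials over the levels. -/

section factorization
variable {p : ℕ}

/-- `γ_1 + ⋯ + γ_{i+1} + i`. -/
def levelParam (γ : Fin (p + 1) → ℝ) (i : ℕ) : ℝ := psum γ (i + 1) + i

theorem levelParam_succ_sub (γ : Fin (p + 1) → ℝ) {i : ℕ} (hi : i < p) :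
    levelParam γ (i + 1) - levelParam γ i = γ (Fin.succ ⟨i, hi⟩) + 1 := by
  unfold levelParam
  rw [psum_succ γ (k := i + 1) (by omega)]
  push_cast
  rw [show (⟨i + 1, by omega⟩ : Fin (p + 1)) = Fin.succ ⟨i, hi⟩ from rfl]
  ring

/-- The `i`-th factor (counted from `0`) of the Jacobi polynomial on the simplex, in terms of the
partial sums `a` and `c` of the indices. -/
noncomputable def levelFactor (γ : Fin (p + 1) → ℝ) (i : ℕ) (a c : ℤ) : MvPolynomial (Fin p) ℝ :=
  jacobiFactor (levelParam γ i) (levelParam γ (i + 1)) a c (Zsum p (i + 2) - Zsum p (i + 1))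
    (Zsum p (i + 2))

theorem jacobiSimplex_eq_prod (γ : Fin (p + 1) → ℝ)
    (hγ : ∀ k : Fin p, ∀ i : ℕ, γ k.succ + 1 + i ≠ 0) (n : Fin p → ℕ) :
    jacobiSimplex p γ n =
      ∏ i ∈ Finset.range p, levelFactor γ i (psum n i : ℕ) (psum n (i + 1) : ℕ) := by
  unfold jacobiSimplex
  rw [← Finset.prod_pow_eq_pow_sum, map_prod, ← Finset.prod_mul_distrib, Finset.prod_range]
  refine Finset.prod_congr rfl fun k _ => ?_
  rw [← mul_assoc, ← map_mul, jacobiHom_eq_homSum _ _ _ (hγ k), levelFactor, jacobiFactor,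
    if_pos (by exact_mod_cast psum_mono n (Nat.le_succ _)), psum_succ n k.2,
    levelParam_succ_sub γ k.2]
  have e : (((psum n (k : ℕ) + n ⟨k, k.2⟩ : ℕ) : ℤ) - ((psum n (k : ℕ) : ℕ) : ℤ)).toNat = n k := by
    push_cast
    simp
  rw [e]
  refine homSum_congr _ _ fun l _ => ?_
  have hl := levelParam_succ_sub γ k.2
  have e1 : γ k.succ = levelParam γ (k + 1) - levelParam γ k - 1 := by rw [hl]; ring
  congr 1
  · push_cast
    ring
  · rw [e1]
    unfold levelParam
    push_cast
    ring

/-- The shifts `ν_{p+1-m} - ν_{p+2-m}` telescope, with `ν_{p+1} = 0` because `j ≤ p`. Thus `ν` is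
the list of shifts of the partial sums of `n`. -/
theorem psum_eq_of_dualShift {j : ℕ} (hjp : j ≤ p) (ν : Fin j → SignType) (n q : Fin p → ℕ)
    (hq : ∀ i, ((q i : ℕ) : ℤ) = dualShift ν n i) (i : ℕ) (hi : i ≤ p) :
    ((psum q i : ℕ) : ℤ) = (psum n i : ℕ) + (entry ν (p + 1 - i) : ℤ) := by
  induction i with
  | zero => simp [psum_zero, entry_of_lt ν (show j < p + 1 by omega)]
  | succ i ih =>
    rw [psum_succ q (k := i) (by omega), psum_succ n (k := i) (by omega)]
    push_cast
    rw [ih (by omega), hq]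
    simp only [dualShift]
    ring

/-- The last `j` factors are listed downwards, in the order in which a path `ν` visits the levels.
-/
theorem prod_range_split {R : Type*} [CommMonoid R] (f : ℕ → R) {j : ℕ} (hjp : j ≤ p) :
    ∏ i ∈ Finset.range p, f i =
      (∏ k ∈ Finset.range j, f (p - 1 - k)) * ∏ i ∈ Finset.range (p - j), f i := by
  rw [← Finset.prod_range_reflect f p]
  conv_lhs => rw [show Finset.range p = Finset.range (j + (p - j)) by rw [Nat.add_sub_cancel' hjp]]
  rw [Finset.prod_range_add]
  congr 1
  rw [← Finset.prod_range_reflect f (p - j)]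
  refine Finset.prod_congr rfl fun k _ => ?_
  congr 1
  omega

end factorization

/-! ### Multiplication by a partial sum of `z` as a sum over shifts. -/

section difference
variable {p j : ℕ} (γ : Fin (p + 1) → ℝ) (n : Fin p → ℕ)

/-- The product of the regularized connection coefficients along the path `ν`; up to sign the
coefficient of the difference operator. -/
noncomputable def pathWeight (ν : Fin j → SignType) : ℝ :=
  ∏ k ∈ Finset.range j, regConnCoeff (levelParam γ (p - 1 - k)) (levelParam γ (p - k))
    ((psum n (p - 1 - k) : ℕ) : ℤ) ((psum n (p - k) : ℕ) : ℤ) (entry ν (k + 2)) (entry ν (k + 1))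

/-- The path `ν` leads from `n` to an index with nonnegative entries. -/
def Admissible (ν : Fin j → SignType) : Prop :=
  ∀ k < j, ((psum n (p - 1 - k) : ℕ) : ℤ) + (entry ν (k + 2) : ℤ) ≤
    ((psum n (p - k) : ℕ) : ℤ) + (entry ν (k + 1) : ℤ)

/-- The conditions under which the regularized coefficients at `n` have no singularity at `γ`. -/
def RegularParams (j : ℕ) : Prop :=
  ∀ k < j, (((psum n (p - k) : ℕ) : ℤ) = 0 → levelParam γ (p - k) + 1 ≠ 0) ∧
    (((psum n (p - k) : ℕ) : ℤ) ≠ 0 → ∀ ε : SignType,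
      2 * (((psum n (p - k) : ℕ) : ℤ) : ℝ) + levelParam γ (p - k) + ε ≠ 0)

variable {γ n}

theorem Admissible.nonneg {ν : Fin j → SignType} (hν : Admissible n ν) (k : ℕ) (hk : k ≤ j) :
    0 ≤ ((psum n (p - k) : ℕ) : ℤ) + (entry ν (k + 1) : ℤ) := by
  induction hk using Nat.decreasingInduction with
  | self =>
    rw [entry_of_lt ν (Nat.lt_succ_self j)]
    simp
  | of_succ k hk ih =>
    have := hν k hk
    rw [show p - (k + 1) = p - 1 - k by omega] at ih
    exact ih.trans this

theorem not_admissible_iff {ν : Fin j → SignType} : ¬ Admissible n ν ↔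
    ∃ k < j, ((psum n (p - k) : ℕ) : ℤ) + (entry ν (k + 1) : ℤ) <
      ((psum n (p - 1 - k) : ℕ) : ℤ) + (entry ν (k + 2) : ℤ) := by
  unfold Admissible
  push Not
  rfl

theorem pathWeight_eq_zero {ν : Fin j → SignType} (hν : ¬ Admissible n ν) :
    pathWeight γ n ν = 0 := by
  obtain ⟨k, hk, hlt⟩ := not_admissible_iff.mp hν
  exact Finset.prod_eq_zero (Finset.mem_range.mpr hk) (regConnCoeff_eq_zero_of_lt hlt)

theorem Admissible.exists_eq_dualShift (hjp : j ≤ p) {ν : Fin j → SignType}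
    (hν : Admissible n ν) : ∃ q : Fin p → ℕ, ∀ i, ((q i : ℕ) : ℤ) = dualShift ν n i := by
  have h : ∀ i : Fin p, 0 ≤ dualShift ν n i := by
    intro i
    have hs := psum_succ n i.2
    unfold dualShift
    by_cases hi : p - 1 - (i : ℕ) < j
    · have := hν _ hi
      rw [show p - 1 - (p - 1 - (i : ℕ)) = i by omega,
        show p - (p - 1 - (i : ℕ)) = i + 1 by omega, hs,
        show p - 1 - (i : ℕ) + 2 = p + 1 - i by omega,
        show p - 1 - (i : ℕ) + 1 = p - i by omega] at this
      push_cast at this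
      linarith
    · rw [entry_of_lt ν (k := p - i) (by omega), entry_of_lt ν (k := p + 1 - i) (by omega)]
      simp
  choose q hq using fun i => Int.eq_ofNat_of_zero_le (h i)
  exact ⟨q, fun i => (hq i).symm⟩

/-- The Jacobi polynomial at the shifted index, split into the factors that the shift moves and the
others. -/
theorem jacobiSimplex_shift (hγ : ∀ k : Fin p, ∀ i : ℕ, γ k.succ + 1 + i ≠ 0) (hjp : j ≤ p)
    {ν : Fin j → SignType} {q : Fin p → ℕ} (hq : ∀ i, ((q i : ℕ) : ℤ) = dualShift ν n i) :
    jacobiSimplex p γ q =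
      (∏ k ∈ Finset.range j, levelFactor γ (p - 1 - k)
        ((psum n (p - 1 - k) : ℕ) + (entry ν (k + 2) : ℤ))
        ((psum n (p - k) : ℕ) + (entry ν (k + 1) : ℤ))) *
      ∏ i ∈ Finset.range (p - j), levelFactor γ i (psum n i : ℕ) (psum n (i + 1) : ℕ) := by
  rw [jacobiSimplex_eq_prod γ hγ, prod_range_split _ hjp]
  congr 1
  · refine Finset.prod_congr rfl fun k hk => ?_
    have := Finset.mem_range.mp hk
    rw [psum_eq_of_dualShift hjp ν n q hq _ (by omega),
      psum_eq_of_dualShift hjp ν n q hq _ (by omega),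
      show p + 1 - (p - 1 - k) = k + 2 by omega, show p - 1 - k + 1 = p - k by omega,
      show p + 1 - (p - k) = k + 1 by omega]
  · refine Finset.prod_congr rfl fun i hi => ?_
    have := Finset.mem_range.mp hi
    rw [psum_eq_of_dualShift hjp ν n q hq _ (by omega),
      psum_eq_of_dualShift hjp ν n q hq _ (by omega), entry_of_lt ν (by omega),
      entry_of_lt ν (by omega)]
    simp

theorem dualShift_zero (i : Fin p) : ((n i : ℕ) : ℤ) = dualShift (0 : Fin j → SignType) n i := by
  simp [dualShift, entry]

/-- Multiplication by `Z_1^{p+1-j}` in terms of shifts of the index. -/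
theorem sum_pathWeight_mul (hγ : ∀ k : Fin p, ∀ i : ℕ, γ k.succ + 1 + i ≠ 0) (hjp : j ≤ p)
    (hreg : RegularParams γ n j) (F : (Fin p → ℤ) → MvPolynomial (Fin p) ℝ)
    (hF : ∀ m : Fin p → ℕ, F (fun i => (m i : ℤ)) = jacobiSimplex p γ m) :
    ∑ ν : Fin j → SignType, MvPolynomial.C (pathWeight γ n ν) * F (dualShift ν n) =
      Zsum p (p + 1 - j) * jacobiSimplex p γ n := by
  -- Step `k` treats level `p - 1 - k`; its state is the shift of `N_1^{p-k}`. The weights carry the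
  -- shifted factors along, so each path assembles its `T_ν J`. The end state `0` leaves the first
  -- power of `Z_1^{p+1-j}`, and at `k = 0` the power is one of `Z_1^{p+1} = 1`. Good states are
  -- those with a nonnegative shifted partial sum.
  have key := prod_mul_eq_sum_paths
    (W := fun k s' s => MvPolynomial.C
      (regConnCoeff (levelParam γ (p - 1 - k)) (levelParam γ (p - k))
        ((psum n (p - 1 - k) : ℕ) : ℤ) ((psum n (p - k) : ℕ) : ℤ) s' s) *
      levelFactor γ (p - 1 - k) ((psum n (p - 1 - k) : ℕ) + (s' : ℤ))
        ((psum n (p - k) : ℕ) + (s : ℤ)))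
    (u := fun k s => Zsum p (p + 1 - k) ^ (1 - (s : ℤ)).toNat)
    (X := fun k => levelFactor γ (p - 1 - k) (psum n (p - 1 - k) : ℕ) (psum n (p - k) : ℕ))
    (good := fun k s => 0 ≤ ((psum n (p - k) : ℕ) : ℤ) + (s : ℤ)) j
    (by
      intro k hk s' hs'
      rw [show p - (k + 1) = p - 1 - k by omega] at hs'
      have hd : ∀ i : ℕ, levelParam γ (p - k) - levelParam γ (p - 1 - k) + i ≠ 0 := by
        intro i
        rw [show p - k = p - 1 - k + 1 by omega,
          levelParam_succ_sub γ (show p - 1 - k < p by omega)]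
        exact hγ _ i
      have hle : ((psum n (p - 1 - k) : ℕ) : ℤ) ≤ ((psum n (p - k) : ℕ) : ℤ) := by
        exact_mod_cast psum_mono n (by omega)
      have := jacobiFactor_contiguous_reg hd (Int.natCast_nonneg _) hle (hreg k hk).1 (hreg k hk).2
        hs' (Zsum p (p - 1 - k + 1)) (Zsum p (p - 1 - k + 2))
      unfold levelFactor
      rw [show p + 1 - (k + 1) = p - 1 - k + 1 by omega, show p + 1 - k = p - 1 - k + 2 by omega,
        mul_comm, show levelParam γ (p - 1 - k + 1) = levelParam γ (p - k) by congr 1; omega, this]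
      refine Finset.sum_congr rfl fun s _ => ?_
      ring)
    (by
      intro k hk s' s hs' hs
      rw [show p - (k + 1) = p - 1 - k by omega] at hs'
      rw [regConnCoeff_eq_zero_of_lt (by omega), map_zero, zero_mul])
    0 (by simp)
  have h0 := jacobiSimplex_shift hγ hjp (dualShift_zero (j := j) (n := n))
  have hk : ∀ k, entry (0 : Fin j → SignType) k = 0 := by intro k; simp [entry]
  simp only [hk, SignType.coe_zero, add_zero] at h0
  rw [h0, ← mul_assoc, mul_comm (Zsum p (p + 1 - j))]
  have e : Zsum p (p + 1 - j) = Zsum p (p + 1 - j) ^ (1 - ((0 : SignType) : ℤ)).toNat := by simp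
  rw [e, key, Finset.sum_mul]
  refine Finset.sum_congr rfl fun ν _ => ?_
  have hone : Zsum p (p + 1 - 0) = 1 := if_neg (by omega)
  rw [hone, one_pow, mul_one, Finset.prod_mul_distrib, ← map_prod]
  simp only [← entry_succ]
  by_cases hν : Admissible n ν
  · obtain ⟨q, hq⟩ := hν.exists_eq_dualShift hjp
    rw [← funext hq, hF, jacobiSimplex_shift hγ hjp hq, ← mul_assoc]
    rfl
  · have : ∏ x ∈ Finset.range j, regConnCoeff (levelParam γ (p - 1 - x)) (levelParam γ (p - x))
        ((psum n (p - 1 - x) : ℕ) : ℤ) ((psum n (p - x) : ℕ) : ℤ) (entry ν (x + 1 + 1))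
          (entry ν (x + 1)) = 0 := pathWeight_eq_zero hν
    rw [this, pathWeight_eq_zero hν]
    simp

/-- At `(1, 0, …, 0)` the variable `v - u` of each factor vanishes, so only its constant coefficient
`1` survives; this point therefore detects the sum of the weights. -/
theorem eval_Zsum (hp : 0 < p) (k : ℕ) :
    MvPolynomial.eval (Pi.single ⟨0, hp⟩ 1) (Zsum p (k + 1)) = 1 := by
  unfold Zsum
  split_ifs with h
  · unfold psum
    rw [map_sum, Finset.sum_eq_single ⟨0, hp⟩]
    · simp
    · intro i _ hi
      split_ifs <;> simp [hi]
    · simp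
  · simp

theorem eval_levelFactor (hp : 0 < p) (i : ℕ) {a c : ℤ} (hac : a ≤ c) :
    MvPolynomial.eval (Pi.single ⟨0, hp⟩ 1) (levelFactor γ i a c) = 1 := by
  rw [levelFactor, jacobiFactor, if_pos hac, homSum, map_sum, Finset.sum_range_succ']
  simp [eval_Zsum, hypCoeff, poch_zero]

theorem eval_jacobiSimplex_single (hγ : ∀ k : Fin p, ∀ i : ℕ, γ k.succ + 1 + i ≠ 0) (hp : 0 < p)
    (m : Fin p → ℕ) :
    MvPolynomial.eval (Pi.single ⟨0, hp⟩ 1) (jacobiSimplex p γ m) = 1 := by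
  rw [jacobiSimplex_eq_prod γ hγ, map_prod]
  exact Finset.prod_eq_one fun i _ =>
    eval_levelFactor hp i (by exact_mod_cast psum_mono m (Nat.le_succ i))

theorem sum_pathWeight (hγ : ∀ k : Fin p, ∀ i : ℕ, γ k.succ + 1 + i ≠ 0) (hp : 0 < p)
    (hjp : j ≤ p) (hreg : RegularParams γ n j) :
    ∑ ν : Fin j → SignType, pathWeight γ n ν = 1 := by
  classical
  have h := sum_pathWeight_mul hγ hjp hreg
    -- The value `1` outside `ℕ^p` makes every shifted term evaluate to `1`, whether or not the path
    -- is admissible.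
    (fun m => if ∀ i, 0 ≤ m i then jacobiSimplex p γ fun i => (m i).toNat else 1)
    (fun m => by simp)
  have h' := congrArg (MvPolynomial.eval (Pi.single (⟨0, hp⟩ : Fin p) (1 : ℝ))) h
  rw [map_mul, map_sum, eval_jacobiSimplex_single hγ hp,
    show p + 1 - j = p - j + 1 by omega, eval_Zsum hp, mul_one] at h'
  rw [← h']
  refine Finset.sum_congr rfl fun ν _ => ?_
  rw [map_mul, MvPolynomial.eval_C]
  split_ifs
  · rw [eval_jacobiSimplex_single hγ hp, mul_one]
  · rw [map_one, mul_one]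

end difference

/-! ### The limits `β_0 → ∞` and `N → ∞` of the dual Racah coefficients. -/

section limits
variable {p j : ℕ}

theorem tendsto_affine_div (A B : ℝ) :
    Tendsto (fun x : ℝ => (A + B * x) / x) atTop (𝓝 B) := by
  have h : Tendsto (fun x : ℝ => A * x⁻¹ + B) atTop (𝓝 (A * 0 + B)) :=
    (tendsto_inv_atTop_zero.const_mul A).add_const B
  rw [mul_zero, zero_add] at h
  refine h.congr' ?_
  filter_upwards [eventually_ne_atTop 0] with x hx
  field_simp

theorem gaugeSign_mul_self (s : SignType) : gaugeSign s * gaugeSign s = 1 := by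
  unfold gaugeSign
  split_ifs <;> norm_num

/-- The factors of the Racah coefficients in the dual variables do not depend on `N`. -/
theorem racahB_translate (a c g h N : ℝ) (s s' : SignType) :
    racahB (-h - 2 * N) (-g - 2 * N) (c + h + N) (a + g + N) s s' =
      racahB (-h) (-g) (c + h) (a + g) s s' := by
  rcases s with _ | _ | _ <;> rcases s' with _ | _ | _ <;>
    simp only [racahB, racahB.B01, racahB.B10, racahB.B11] <;> ring

/-- Needed when `j = p`: the boundary value `x_{p+1} = N` is the image under `x ↦ -x - β_{p+1}` of
`γ_1 + N`, the value that the formula for the other `x_k` would give. -/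
theorem racahB_zero_invol (b b' x x' : ℝ) (s : SignType) :
    racahB b b' x (-x' - b') s 0 = racahB b b' x x' s 0 := by
  rcases s with _ | _ | _ <;>
    simp only [racahB, racahB.B10] <;> ring

theorem racahb_translate (c h N : ℝ) (s : SignType) :
    racahb (-h - 2 * N) (c + h + N) s = racahb (-h) (c + h) s := by
  rcases s with _ | _ | _ <;> simp only [racahb] <;> ring

theorem connCoeff_eq_gauge_mul (a c g h : ℝ) (s' s : SignType) :
    (if s = 0 then 2 else 1) * racahB (-h) (-g) (c + h) (a + g) s s' / racahb (-h) (c + h) s =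
      gaugeSign s' * gaugeSign s * connCoeff a c g h s' s := by
  unfold connCoeff
  linear_combination (-((if s = 0 then 2 else 1) * racahB (-h) (-g) (c + h) (a + g) s s' /
    racahb (-h) (c + h) s) * gaugeSign s * gaugeSign s) * gaugeSign_mul_self s' -
    ((if s = 0 then 2 else 1) * racahB (-h) (-g) (c + h) (a + g) s s' /
    racahb (-h) (c + h) s) * gaugeSign_mul_self s

/-- The product of the connection coefficients along the path `ν`. -/
noncomputable def pathProd (γ : Fin (p + 1) → ℝ) (n : Fin p → ℕ) (ν : Fin j → SignType) : ℝ :=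
  ∏ k ∈ Finset.range j, connCoeff ((psum n (p - 1 - k) : ℕ) : ℤ) ((psum n (p - k) : ℕ) : ℤ)
    (levelParam γ (p - 1 - k)) (levelParam γ (p - k)) (entry ν (k + 2)) (entry ν (k + 1))

/-- The gauge signs telescope along a path. Since `ν_{j+1} = 0`, only the sign of `ν_1` remains, and
it is cancelled by the one in the slope of `B_0` (`leadSlope_eq`). -/
theorem prod_gaugeSign (σ : ℕ → SignType) (j : ℕ) :
    ∏ k ∈ Finset.range j, gaugeSign (σ (k + 1)) * gaugeSign (σ k) =
      gaugeSign (σ j) * gaugeSign (σ 0) := by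
  induction j with
  | zero => simp [gaugeSign_mul_self]
  | succ j ih =>
    rw [Finset.prod_range_succ, ih]
    linear_combination (gaugeSign (σ (j + 1)) * gaugeSign (σ 0)) * gaugeSign_mul_self (σ j)

theorem dualBeta_succ (γ : Fin (p + 1) → ℝ) (β₀ N : ℝ) {k : ℕ} (hk : k ≤ p) :
    dualBeta γ β₀ N (k + 1) = -levelParam γ (p - k) - 2 * N := by
  unfold dualBeta hahnBeta levelParam
  rw [if_neg (Nat.succ_ne_zero k), show p + 2 - (k + 1) = p - k + 1 by omega]
  push_cast
  ring

theorem dualX_succ (γ : Fin (p + 1) → ℝ) (β₀ N : ℝ) (n : Fin p → ℕ) {k : ℕ} (hk : k < p) :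
    dualX γ β₀ N n (k + 1) = (((psum n (p - k) : ℕ) : ℤ) : ℝ) + levelParam γ (p - k) + N := by
  unfold dualX hahnBeta levelParam
  rw [if_neg (Nat.succ_ne_zero k), if_neg (by omega), show p + 2 - (k + 1) = p - k + 1 by omega,
    show p + 1 - (k + 1) = p - k by omega]
  push_cast
  ring

/-- Isolates `B_0`, so that the remaining factor depends neither on `β_0` nor on `N`. -/
theorem coeffRacah_eq (hjp : j ≤ p) (γ : Fin (p + 1) → ℝ) (β₀ N : ℝ) (n : Fin p → ℕ)
    (ν : Fin j → SignType) :
    coeffRacah p j γ β₀ N n ν =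
      racahB β₀ (dualBeta γ β₀ N 1) 0 (dualX γ β₀ N n 1) 0 (entry ν 1) *
        (gaugeSign (entry ν 1) * pathProd γ n ν) := by
  have h2 : (2 : ℝ) ^ (Finset.univ.filter fun i => ν i = 0).card =
      ∏ k ∈ Finset.range j, if entry ν (k + 1) = 0 then 2 else 1 := by
    rw [← Finset.prod_const, Finset.prod_filter, Finset.prod_range]
    refine Finset.prod_congr rfl fun i _ => ?_
    rw [entry_succ, extend, dif_pos i.2]
  have h3 : ∏ k ∈ Finset.Icc 1 j, racahb (dualBeta γ β₀ N k) (dualX γ β₀ N n k) (entry ν k) =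
      ∏ k ∈ Finset.range j, racahb (dualBeta γ β₀ N (k + 1)) (dualX γ β₀ N n (k + 1))
        (entry ν (k + 1)) := by
    rw [Finset.range_eq_Ico, Finset.prod_Ico_add' (fun k => racahb (dualBeta γ β₀ N k)
      (dualX γ β₀ N n k) (entry ν k)) 0 j 1]
    rfl
  unfold coeffRacah racahC
  rw [Finset.prod_range_succ', h2, h3]
  have h4 : gaugeSign (entry ν 1) * pathProd γ n ν = ∏ k ∈ Finset.range j,
      ((if entry ν (k + 1) = 0 then 2 else 1) *
        racahB (dualBeta γ β₀ N (k + 1)) (dualBeta γ β₀ N (k + 1 + 1)) (dualX γ β₀ N n (k + 1))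
          (dualX γ β₀ N n (k + 1 + 1)) (entry ν (k + 1)) (entry ν (k + 1 + 1)) /
        racahb (dualBeta γ β₀ N (k + 1)) (dualX γ β₀ N n (k + 1)) (entry ν (k + 1))) := by
    have hg := prod_gaugeSign (fun k => entry ν (k + 1)) j
    rw [entry_of_lt ν (Nat.lt_succ_self j), show gaugeSign 0 = 1 from if_pos rfl, one_mul] at hg
    rw [zero_add] at hg
    rw [← hg, pathProd, ← Finset.prod_mul_distrib]
    refine Finset.prod_congr rfl fun k hk => ?_
    have hk' := Finset.mem_range.mp hk
    rw [← connCoeff_eq_gauge_mul, dualBeta_succ γ β₀ N (by omega), dualBeta_succ γ β₀ N (by omega),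
      dualX_succ γ β₀ N n (by omega), racahb_translate, show p - (k + 1) = p - 1 - k by omega]
    congr 2
    rw [← racahB_translate _ _ _ _ N]
    by_cases hlast : k + 1 < p
    · rw [dualX_succ γ β₀ N n hlast, show p - (k + 1) = p - 1 - k by omega]
    · rw [show k + 1 + 1 = p + 1 by omega, entry_of_lt ν (k := p + 1) (by omega),
        ← racahB_zero_invol _ _ _ (dualX γ β₀ N n (p + 1))]
      congr 1
      unfold dualX
      rw [if_neg (Nat.succ_ne_zero p), if_pos rfl, show p - 1 - k = 0 by omega, psum_zero]
      simp
      ring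
  rw [h4, Finset.prod_div_distrib, Finset.prod_mul_distrib, zero_add,
    entry, dif_neg (by omega), show dualBeta γ β₀ N 0 = β₀ from if_pos rfl,
    show dualX γ β₀ N n 0 = 0 from if_pos rfl]
  ring

/-- The slope in `β_0` of the first factor of the Racah coefficients. -/
noncomputable def leadSlope (G c N : ℝ) (s : SignType) : ℝ :=
  if s = 0 then -(G + 1) / 2 - N else if s = 1 then -c + N else c + G + N

theorem racahB_first_eq (G c N : ℝ) (s : SignType) :
    ∃ A, ∀ β₀ : ℝ, racahB β₀ (-G - 2 * N) 0 (c + G + N) 0 s = A + leadSlope G c N s * β₀ := by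
  have h1 : (1 : SignType) ≠ 0 := by decide
  have h2 : (-1 : SignType) ≠ 0 := by decide
  have h3 : (-1 : SignType) ≠ 1 := by decide
  rcases s with _ | _ | _
  · refine ⟨(c + G + N) * (c + G + N + (-G - 2 * N)) + (-G - 2 * N - 1) / 2, fun β₀ => ?_⟩
    simp only [racahB, ← SignType.zero_eq_zero, leadSlope, if_true]
    ring
  · refine ⟨(c + G + N) ^ 2, fun β₀ => ?_⟩
    simp only [SignType.neg_eq_neg_one, leadSlope, if_neg h2, if_neg h3]
    change (-(c + G + N) - (-G - 2 * N) + 0 + (-G - 2 * N)) *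
      (-(c + G + N) - (-G - 2 * N) - 0 + (-G - 2 * N) - β₀) = _
    ring
  · refine ⟨(c - N) ^ 2, fun β₀ => ?_⟩
    simp only [SignType.pos_eq_one, leadSlope, if_neg h1, if_true]
    change (c + G + N + 0 + (-G - 2 * N)) * (c + G + N - 0 + (-G - 2 * N) - β₀) = _
    ring

theorem leadSlope_eq (G c : ℝ) (s : SignType) :
    ∃ A, ∀ N : ℝ, leadSlope G c N s = A + (-gaugeSign s) * N := by
  unfold leadSlope gaugeSign
  split_ifs
  · exact ⟨-(G + 1) / 2, fun N => by ring⟩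
  · exact ⟨-c, fun N => by ring⟩
  · exact ⟨c + G, fun N => by ring⟩

theorem tendsto_coeffRacah (hj : 1 ≤ j) (hjp : j ≤ p) (γ : Fin (p + 1) → ℝ) (N : ℝ) (n : Fin p → ℕ)
    (ν : Fin j → SignType) :
    Tendsto (fun β₀ : ℝ => coeffRacah p j γ β₀ N n ν / β₀) atTop
      (𝓝 (leadSlope (levelParam γ p) ((psum n p : ℕ) : ℤ) N (entry ν 1) *
        (gaugeSign (entry ν 1) * pathProd γ n ν))) := by
  obtain ⟨A, hA⟩ := racahB_first_eq (levelParam γ p) ((psum n p : ℕ) : ℤ) N (entry ν 1)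
  refine ((tendsto_affine_div A _).mul_const _).congr fun β₀ => ?_
  rw [coeffRacah_eq hjp, dualBeta_succ γ β₀ N (Nat.zero_le p), dualX_succ γ β₀ N n (by omega),
    Nat.sub_zero, hA]
  ring

theorem coeffHahn_eq (hj : 1 ≤ j) (hjp : j ≤ p) (γ : Fin (p + 1) → ℝ) (N : ℝ) (n : Fin p → ℕ)
    (ν : Fin j → SignType) :
    coeffHahn p j γ N n ν = leadSlope (levelParam γ p) ((psum n p : ℕ) : ℤ) N (entry ν 1) *
        (gaugeSign (entry ν 1) * pathProd γ n ν) :=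
  (tendsto_coeffRacah hj hjp γ N n ν).limUnder_eq

theorem tendsto_coeffHahn (hj : 1 ≤ j) (hjp : j ≤ p) (γ : Fin (p + 1) → ℝ) (n : Fin p → ℕ)
    (ν : Fin j → SignType) :
    Tendsto (fun N : ℝ => coeffHahn p j γ N n ν / N) atTop (𝓝 (-pathProd γ n ν)) := by
  obtain ⟨A, hA⟩ := leadSlope_eq (levelParam γ p) ((psum n p : ℕ) : ℤ) (entry ν 1)
  have h := (tendsto_affine_div A (-gaugeSign (entry ν 1))).mul_const
    (gaugeSign (entry ν 1) * pathProd γ n ν)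
  rw [show -gaugeSign (entry ν 1) * (gaugeSign (entry ν 1) * pathProd γ n ν) = -pathProd γ n ν by
    linear_combination (-pathProd γ n ν) * gaugeSign_mul_self (entry ν 1)] at h
  refine h.congr fun N => ?_
  rw [coeffHahn_eq hj hjp, hA]
  ring

/-- Valid at every `γ` with the convention `x / 0 = 0`; genericity matters only when `pathProd` is
compared with the regularized `pathWeight`. -/
theorem coeffJacobi_eq (hj : 1 ≤ j) (hjp : j ≤ p) (γ : Fin (p + 1) → ℝ) (n : Fin p → ℕ)
    (ν : Fin j → SignType) : coeffJacobi p j γ n ν = -pathProd γ n ν :=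
  (tendsto_coeffHahn hj hjp γ n ν).limUnder_eq

end limits

/-! ### Generic parameters, removable singularities and the difference equation. -/

section generic
variable {p j : ℕ} {γ : Fin (p + 1) → ℝ} {n : Fin p → ℕ}

theorem genericParams_spec (hγ : γ ∈ genericParams p j n) {k : ℕ} (hk : k < j) (hjp : j ≤ p)
    (ε : SignType) :
    2 * (((psum n (p - k) : ℕ) : ℤ) : ℝ) + levelParam γ (p - k) + ε ≠ 0 := by
  have := hγ (p - k) (by omega) (by omega) ε
  rw [levelParam]
  push_cast
  rwa [← add_assoc]

theorem neg_one_lt_levelParam (hγ : ∀ i, -1 < γ i) {i : ℕ} (hi : i ≤ p) :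
    -1 < levelParam γ i := by
  induction i with
  | zero =>
    rw [levelParam, psum_succ γ (Nat.succ_pos p), psum_zero]
    simpa using hγ _
  | succ i ih =>
    have h1 := levelParam_succ_sub γ (show i < p by omega)
    have h2 := hγ (Fin.succ ⟨i, by omega⟩)
    have h3 := ih (by omega)
    linarith

/-- If all `γ_i > -1`, then `h > -1` at each level, so `2c + h + ε > 0` as soon as `c ≥ 1`; at `c =
0` the regularized coefficients have only the denominator `h + 1`. -/
theorem regularParams_of (hjp : j ≤ p) (h : γ ∈ genericParams p j n ∨ ∀ i, -1 < γ i) :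
    RegularParams γ n j := by
  intro k hk
  rcases h with h | h
  · refine ⟨fun h0 => ?_, fun _ => genericParams_spec h hk hjp⟩
    have := genericParams_spec h hk hjp 1
    rw [h0] at this
    simpa using this
  · have h1 := neg_one_lt_levelParam h (show p - k ≤ p by omega)
    refine ⟨fun _ => by linarith, fun h0 ε => ?_⟩
    have h2 : (1 : ℝ) ≤ (((psum n (p - k) : ℕ) : ℤ) : ℝ) := by
      exact_mod_cast Nat.one_le_iff_ne_zero.mpr (by exact_mod_cast h0)
    have h3 : (-1 : ℝ) ≤ (ε : ℝ) := by
      rcases ε with _ | _ | _ <;> simp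
    linarith

/-- Admissibility makes every shifted partial sum nonnegative, as the comparison at `c = 0`
requires. On the other paths both products vanish. -/
theorem pathProd_eq_pathWeight (hjp : j ≤ p) (hγ : γ ∈ genericParams p j n) {ν : Fin j → SignType}
    (hν : Admissible n ν) : pathProd γ n ν = pathWeight γ n ν := by
  refine Finset.prod_congr rfl fun k hk => ?_
  have hk' := Finset.mem_range.mp hk
  have h0 := hν.nonneg (k + 1) hk'
  rw [show p - (k + 1) = p - 1 - k by omega] at h0
  rw [regConnCoeff_eq_connCoeff (Int.natCast_nonneg _)
    (by exact_mod_cast psum_mono n (by omega)) (genericParams_spec hγ hk' hjp) h0]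

theorem pathProd_eq_zero {ν : Fin j → SignType} (hν : ¬ Admissible n ν) :
    pathProd γ n ν = 0 := by
  obtain ⟨k, hk, hlt⟩ := not_admissible_iff.mp hν
  exact Finset.prod_eq_zero (Finset.mem_range.mpr hk)
    (connCoeff_eq_zero_of_lt (by exact_mod_cast psum_mono n (by omega)) hlt)

theorem continuous_psum (k : ℕ) : Continuous fun γ : Fin (p + 1) → ℝ => psum γ k := by
  unfold psum
  refine continuous_finsetSum _ fun i _ => ?_
  split_ifs
  · exact continuous_apply i
  · exact continuous_const

theorem continuous_levelParam (i : ℕ) : Continuous fun γ : Fin (p + 1) → ℝ => levelParam γ i :=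
  (continuous_psum _).add continuous_const

theorem continuousAt_connCoeff {X : Type*} [TopologicalSpace X] {g h : X → ℝ} {x : X}
    (hg : ContinuousAt g x) (hh : ContinuousAt h x) (a c : ℝ)
    (hc : ∀ ε : SignType, 2 * c + h x + ε ≠ 0) (s' s : SignType) :
    ContinuousAt (fun y => connCoeff a c (g y) (h y) s' s) x := by
  have h0 := hc 0
  have hp := hc 1
  have hm := hc (-1)
  simp only [SignType.coe_zero, SignType.coe_one, SignType.coe_neg_one, add_zero,
    ← sub_eq_add_neg] at h0 hp hm
  rcases s' with _ | _ | _ <;> rcases s with _ | _ | _ <;>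
    simp only [SignType.zero_eq_zero, SignType.neg_eq_neg_one, SignType.pos_eq_one,
      connCoeff_zero_zero, connCoeff_zero_one, connCoeff_zero_neg, connCoeff_one_zero,
      connCoeff_one_one, connCoeff_one_neg, connCoeff_neg_zero, connCoeff_neg_one,
      connCoeff_neg_neg] <;>
    refine ContinuousAt.div (by fun_prop) (by fun_prop) (mul_ne_zero ?_ ?_) <;> assumption

theorem continuousAt_pathWeight (hreg : RegularParams γ n j) (ν : Fin j → SignType) :
    ContinuousAt (fun γ' => pathWeight γ' n ν) γ := by
  unfold pathWeight
  refine tendsto_finsetProd _ fun k hk => ?_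
  obtain ⟨h1, h2⟩ := hreg k (Finset.mem_range.mp hk)
  have hg := (continuous_levelParam (p := p) (p - 1 - k)).continuousAt (x := γ)
  have hh := (continuous_levelParam (p := p) (p - k)).continuousAt (x := γ)
  change ContinuousAt (fun γ' => regConnCoeff (levelParam γ' (p - 1 - k)) (levelParam γ' (p - k))
    ((psum n (p - 1 - k) : ℕ) : ℤ) ((psum n (p - k) : ℕ) : ℤ) (entry ν (k + 2))
      (entry ν (k + 1))) γ
  unfold regConnCoeff
  split_ifs with i1 i2 i3 i4
  · exact continuousAt_const
  · exact (hg.add continuousAt_const).div (hh.add continuousAt_const) (h1 i2)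
  · exact (hh.sub hg).div (hh.add continuousAt_const) (h1 i2)
  · exact continuousAt_const
  · exact continuousAt_connCoeff hg hh _ _ (h2 i2) _ _

/-- Adding `t` to `γ_1` moves every nonempty partial sum by `t`, so each of finitely many conditions
excludes one value of `t`. Density makes the filter in `coeffN` nontrivial, hence its limit unique.
-/
theorem mem_closure_genericParams (j : ℕ) (γ : Fin (p + 1) → ℝ) (n : Fin p → ℕ) :
    γ ∈ closure (genericParams p j n) := by
  have hpsum : ∀ (t : ℝ) (m : ℕ), psum (γ + (Pi.single 0 t : Fin (p + 1) → ℝ)) (m + 1) =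
      psum γ (m + 1) + t := by
    intro t m
    unfold psum
    have : ∀ i : Fin (p + 1),
        (if (i : ℕ) < m + 1 then (γ + (Pi.single 0 t : Fin (p + 1) → ℝ)) i else 0) =
        (if (i : ℕ) < m + 1 then γ i else 0) + if i = 0 then t else 0 := by
      intro i
      by_cases hi : i = 0
      · subst hi
        simp
      · simp [hi]
    rw [Finset.sum_congr rfl fun i _ => this i, Finset.sum_add_distrib]
    simp
  have hcont : Tendsto (fun t : ℝ => γ + (Pi.single 0 t : Fin (p + 1) → ℝ)) (𝓝[≠] 0) (𝓝 γ) := by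
    have : Continuous fun t : ℝ => γ + (Pi.single 0 t : Fin (p + 1) → ℝ) :=
      continuous_const.add (continuous_single (A := fun _ : Fin (p + 1) => ℝ) 0)
    have h := this.tendsto 0
    rw [Pi.single_zero, add_zero] at h
    exact h.mono_left nhdsWithin_le_nhds
  refine mem_closure_of_tendsto hcont ?_
  have hne : ∀ x : ℝ, ∀ᶠ t : ℝ in 𝓝[≠] 0, x + t ≠ 0 := by
    intro x
    by_cases hx : x = 0
    · filter_upwards [self_mem_nhdsWithin] with t ht
      rwa [hx, zero_add]
    · have : ∀ᶠ t : ℝ in 𝓝 0, x + t ≠ 0 :=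
        (continuous_const.add continuous_id).continuousAt.eventually_ne (by simpa using hx)
      exact nhdsWithin_le_nhds this
  have hall : ∀ᶠ t : ℝ in 𝓝[≠] 0, ∀ m ∈ Finset.range (p + 1), ∀ ε : SignType,
      (2 * ((psum n m : ℕ) : ℝ) + psum γ (m + 1) + m + (ε : ℝ)) + t ≠ 0 := by
    rw [Filter.eventually_all_finset]
    exact fun m _ => Filter.eventually_all.mpr fun ε => hne _
  filter_upwards [hall] with t ht
  intro m _ hm ε
  rw [hpsum]
  convert ht m (Finset.mem_range.mpr (Nat.lt_succ_of_le hm)) ε using 1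
  ring

theorem tendsto_coeffJacobi (hj : 1 ≤ j) (hjp : j ≤ p) (hreg : RegularParams γ n j)
    (ν : Fin j → SignType) :
    Tendsto (fun γ' => coeffJacobi p j γ' n ν) (𝓝[genericParams p j n] γ)
      (𝓝 (-pathWeight γ n ν)) := by
  simp only [coeffJacobi_eq hj hjp]
  by_cases hν : Admissible n ν
  · refine ((continuousAt_pathWeight hreg ν).neg.mono_left nhdsWithin_le_nhds).congr' ?_
    filter_upwards [self_mem_nhdsWithin] with γ' hγ'
    rw [pathProd_eq_pathWeight hjp hγ' hν]
    rfl
  · simp only [pathProd_eq_zero hν, pathWeight_eq_zero hν]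
    exact tendsto_const_nhds

theorem coeffN_eq (hj : 1 ≤ j) (hjp : j ≤ p) (hreg : RegularParams γ n j)
    (ν : Fin j → SignType) : coeffN p j γ n ν = -pathWeight γ n ν := by
  have : (𝓝[genericParams p j n] γ).NeBot :=
    mem_closure_iff_nhdsWithin_neBot.mp (mem_closure_genericParams j γ n)
  exact (tendsto_coeffJacobi hj hjp hreg ν).limUnder_eq

theorem opN_jacobiSimplex (hγ : ∀ k : Fin p, ∀ i : ℕ, γ k.succ + 1 + i ≠ 0) (hj : 1 ≤ j)
    (hjp : j ≤ p) (hreg : RegularParams γ n j) (F : (Fin p → ℤ) → MvPolynomial (Fin p) ℝ)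
    (hF : ∀ m : Fin p → ℕ, F (fun i => (m i : ℤ)) = jacobiSimplex p γ m) :
    opN p j γ F n = kappaHat p j * jacobiSimplex p γ n := by
  -- The summand at `ν = 0` is zero on the right as well, so the sum may run over all `ν`.
  have e : opN p j γ F n = ∑ ν : Fin j → SignType,
      (MvPolynomial.C (pathWeight γ n ν) * jacobiSimplex p γ n -
        MvPolynomial.C (pathWeight γ n ν) * F (dualShift ν n)) := by
    refine Finset.sum_congr rfl fun ν _ => ?_
    split_ifs with h0
    · subst h0
      rw [← funext (dualShift_zero (j := j) (n := n)), hF, sub_self]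
    · rw [coeffN_eq hj hjp hreg, hF, map_neg]
      ring
  rw [e, Finset.sum_sub_distrib, sum_pathWeight_mul hγ hjp hreg F hF, ← Finset.sum_mul, ← map_sum,
    sum_pathWeight hγ (by omega) hjp hreg, map_one, kappaHat, Zsum, if_pos (by omega)]
  ring

end generic

/-! ### The coordinates `Z_1^1, …, Z_1^p`. -/

section coordinates
variable {p : ℕ}

/-- The commutator is a derivation that kills the variables. -/
theorem pderiv_pderiv_comm {σ : Type*} (l m : σ) (f : MvPolynomial σ ℝ) :
    MvPolynomial.pderiv l (MvPolynomial.pderiv m f) =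
      MvPolynomial.pderiv m (MvPolynomial.pderiv l f) := by
  classical
  have h : ⁅MvPolynomial.pderiv (R := ℝ) l, MvPolynomial.pderiv (R := ℝ) m⁆ = 0 := by
    refine MvPolynomial.derivation_ext fun i => ?_
    simp only [Derivation.commutator_apply, MvPolynomial.pderiv_X, Pi.single_apply]
    split_ifs <;> simp
  have h' := congrArg (fun D => D f) h
  simpa [Derivation.commutator_apply, sub_eq_zero] using h'

/-- Differentiation with respect to `Z_1^{k+1}` in the coordinates `Z_1^1, …, Z_1^p`. -/
noncomputable def derivZ (p k : ℕ) :
    Derivation ℝ (MvPolynomial (Fin p) ℝ) (MvPolynomial (Fin p) ℝ) :=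
  MvPolynomial.mkDerivation ℝ fun i : Fin p =>
    if (i : ℕ) = k then 1 else if (i : ℕ) = k + 1 then -1 else 0

theorem derivZ_psum (k : ℕ) {t : ℕ} (ht : t ≤ p) :
    derivZ p k (psum (fun i : Fin p => (MvPolynomial.X i : MvPolynomial (Fin p) ℝ)) t) =
      if k + 1 = t then 1 else 0 := by
  induction t with
  | zero => simp [psum_zero]
  | succ t ih =>
    rw [psum_succ _ (show t < p by omega), map_add, ih (by omega), derivZ,
      MvPolynomial.mkDerivation_X]
    dsimp only
    split_ifs <;> first | omega | simp

theorem derivZ_Zsum {k : ℕ} (hk : k < p) (l : ℕ) :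
    derivZ p k (Zsum p (l + 1)) = if k = l then 1 else 0 := by
  unfold Zsum
  split_ifs with h1 h2 h2
  · rw [derivZ_psum k h1, if_pos (by omega)]
  · rw [derivZ_psum k h1, if_neg (by omega)]
  · omega
  · simp

theorem sum_derivation_apply {ι : Type*} (s : Finset ι)
    (D : ι → Derivation ℝ (MvPolynomial (Fin p) ℝ) (MvPolynomial (Fin p) ℝ))
    (f : MvPolynomial (Fin p) ℝ) : (∑ k ∈ s, D k) f = ∑ k ∈ s, D k f := by
  have h := congrFun (map_sum Derivation.coeFnAddMonoidHom D s) f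
  rwa [Finset.sum_apply] at h

/-- The chain rule; both sides are derivations, so the variables suffice. -/
theorem pderiv_eq_sum_derivZ (m : Fin p) (f : MvPolynomial (Fin p) ℝ) :
    MvPolynomial.pderiv m f =
      ∑ k ∈ Finset.range p, if (m : ℕ) ≤ k then derivZ p k f else 0 := by
  classical
  have h : MvPolynomial.pderiv (R := ℝ) m =
      ∑ k ∈ Finset.range p, if (m : ℕ) ≤ k then derivZ p k else 0 := by
    refine MvPolynomial.derivation_ext fun i => ?_
    rw [MvPolynomial.pderiv_X, sum_derivation_apply]
    -- The sum telescopes. The value `-1` is the boundary term at `i = t`, which does not occur for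
    -- `t = p`.
    have e : ∀ t : ℕ, ∑ k ∈ Finset.range t,
        (if (m : ℕ) ≤ k then derivZ p k else 0) (MvPolynomial.X i) =
        (if (m : ℕ) = i ∧ (i : ℕ) < t then 1 else if (m : ℕ) < t ∧ (i : ℕ) = t then -1 else 0) := by
      intro t
      induction t with
      | zero => simp
      | succ t ih =>
        rw [Finset.sum_range_succ, ih]
        by_cases hmt : (m : ℕ) ≤ t
        · rw [if_pos hmt, derivZ, MvPolynomial.mkDerivation_X]
          split_ifs <;> first | omega | simp
        · rw [if_neg hmt]
          split_ifs <;> first | omega | simp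
    rw [e, Pi.single_apply]
    have := i.2
    split_ifs <;> first | rfl | (exfalso; simp_all [Fin.ext_iff])
  rw [h, sum_derivation_apply]
  refine Finset.sum_congr rfl fun k _ => ?_
  split_ifs <;> rfl

end coordinates

/-! ### Euler's identity and the Jacobi differential equation for one factor. -/

section ode

variable {p : ℕ}

theorem jacobiCoeff_succ (n : ℕ) (α β : ℝ) (i : ℕ) (hi : i < n) :
    jacobiCoeff n α β (i + 1) * ((i + 1) * (i + 1 + α)) =
      jacobiCoeff n α β i * ((i - n) * (i + n + α + β + 1)) := by
  unfold jacobiCoeff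
  rw [poch_succ, poch_succ, Nat.factorial_succ, show n - i = n - (i + 1) + 1 by omega,
    poch_succ_left (α + 1 + i)]
  have h1 : (i.factorial : ℝ) ≠ 0 := by positivity
  have h2 : (n.factorial : ℝ) ≠ 0 := by positivity
  have h3 : (i : ℝ) + 1 ≠ 0 := by positivity
  push_cast
  rw [← add_assoc (α + 1) (i : ℝ) 1]
  field_simp
  ring

theorem derivation_monomial (E : Derivation ℝ (MvPolynomial (Fin p) ℝ) (MvPolynomial (Fin p) ℝ))
    {u v : MvPolynomial (Fin p) ℝ} {x y : ℝ} (hu : E u = MvPolynomial.C x * u)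
    (hv : E v = MvPolynomial.C y * v) (c : ℝ) (i m : ℕ) :
    E (MvPolynomial.C c * u ^ i * v ^ m) =
      MvPolynomial.C ((i * x + m * y) * c) * u ^ i * v ^ m := by
  have hpow : ∀ (w : MvPolynomial (Fin p) ℝ) (z : ℝ) (k : ℕ), E w = MvPolynomial.C z * w →
      E (w ^ k) = MvPolynomial.C (k * z) * w ^ k := by
    intro w z k hw
    induction k with
    | zero => simp
    | succ k ih =>
      rw [pow_succ, Derivation.leibniz, ih, hw]
      simp only [smul_eq_mul, map_mul, map_natCast]
      push_cast
      ring
  have hC : E (MvPolynomial.C c) = 0 := by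
    rw [← MvPolynomial.algebraMap_eq]
    exact E.map_algebraMap c
  rw [Derivation.leibniz, Derivation.leibniz, hC, hpow u x i hu, hpow v y m hv]
  simp only [smul_eq_mul, map_mul, map_add, map_natCast]
  ring

/-- Euler's identity for the homogeneous Jacobi polynomials. -/
theorem euler_jacobiHom (E : Derivation ℝ (MvPolynomial (Fin p) ℝ) (MvPolynomial (Fin p) ℝ))
    {u v : MvPolynomial (Fin p) ℝ} (hu : E u = u) (hv : E v = v) (n : ℕ) (α β : ℝ) :
    E (jacobiHom n α β u v) = MvPolynomial.C (n : ℝ) * jacobiHom n α β u v := by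
  unfold jacobiHom
  rw [map_sum, Finset.mul_sum]
  refine Finset.sum_congr rfl fun i hi => ?_
  have hi' : i ≤ n := Nat.lt_succ_iff.mp (Finset.mem_range.mp hi)
  rw [derivation_monomial E (x := 1) (y := 1) (by simpa using hu) (by simpa using hv),
    Nat.cast_sub hi', show ((i : ℝ) * 1 + (n - i) * 1) = n by ring, map_mul]
  ring

theorem derivation_jacobiHom_eq_zero
    (E : Derivation ℝ (MvPolynomial (Fin p) ℝ) (MvPolynomial (Fin p) ℝ))
    {u v : MvPolynomial (Fin p) ℝ} (hu : E u = 0) (hv : E v = 0) (n : ℕ) (α β : ℝ) :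
    E (jacobiHom n α β u v) = 0 := by
  unfold jacobiHom
  rw [map_sum]
  refine Finset.sum_eq_zero fun i _ => ?_
  rw [derivation_monomial E (x := 0) (y := 0) (by simpa using hu) (by simpa using hv)]
  simp

/-- The homogeneous form of the differential equation of the Jacobi polynomials. -/
theorem jacobiHom_ode (E : Derivation ℝ (MvPolynomial (Fin p) ℝ) (MvPolynomial (Fin p) ℝ))
    {u v : MvPolynomial (Fin p) ℝ} (hu : E u = u) (hv : E v = 0) (n : ℕ) (α β : ℝ) :
    v * (MvPolynomial.C α * E (jacobiHom n α β u v) + E (E (jacobiHom n α β u v))) =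
      u * (E (E (jacobiHom n α β u v)) + MvPolynomial.C (α + β + 1) * E (jacobiHom n α β u v) -
        MvPolynomial.C (n * (n + α + β + 1)) * jacobiHom n α β u v) := by
  have hE : ∀ c : ℕ → ℝ, E (∑ i ∈ Finset.range (n + 1), MvPolynomial.C (c i) * u ^ i * v ^ (n - i)) =
      ∑ i ∈ Finset.range (n + 1), MvPolynomial.C (i * c i) * u ^ i * v ^ (n - i) := by
    intro c
    rw [map_sum]
    refine Finset.sum_congr rfl fun i _ => ?_
    rw [derivation_monomial E (x := 1) (y := 0) (by simpa using hu) (by simpa using hv)]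
    simp
  unfold jacobiHom
  rw [hE, hE fun i => i * jacobiCoeff n α β i]
  simp only [Finset.mul_sum, ← Finset.sum_add_distrib, ← Finset.sum_sub_distrib]
  -- `E` multiplies `u^i` by `i`, so the `i = 0` term on the left vanishes; on the right the `i = n`
  -- term cancels. Term `i + 1` on the left matches term `i` on the right by `jacobiCoeff_succ`.
  rw [Finset.sum_range_succ', Finset.sum_range_succ]
  have e1 : ∀ x y : MvPolynomial (Fin p) ℝ, x = 0 → y = 0 → ∀ z w, z = w → z + x = w + y := by
    rintro x y rfl rfl z w rfl
    rfl
  apply e1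
  · simp
  · have : ∀ a b c : MvPolynomial (Fin p) ℝ, (MvPolynomial.C (n * (n * jacobiCoeff n α β n)) * a * b +
        MvPolynomial.C (α + β + 1) * (MvPolynomial.C (n * jacobiCoeff n α β n) * a * b) -
        MvPolynomial.C (n * (n + α + β + 1)) * (MvPolynomial.C (jacobiCoeff n α β n) * a * b)) = 0 := by
      intro a b c
      simp only [map_mul, map_add, map_natCast, map_one]
      ring
    rw [this _ _ 0]
    ring
  · refine Finset.sum_congr rfl fun i hi => ?_
    have hi' : i < n := Finset.mem_range.mp hi
    have h := congrArg (MvPolynomial.C (σ := Fin p)) (jacobiCoeff_succ n α β i hi')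
    rw [show n - i = n - (i + 1) + 1 by omega]
    simp only [map_mul, map_add, map_sub, map_natCast, map_one, pow_succ, Nat.cast_add,
      Nat.cast_one] at h ⊢
    linear_combination (u ^ i * u * v ^ (n - (i + 1)) * v) * h

end ode

/-! ### The differential operator in the coordinates `Z_1^k`. -/

section opZ
variable {p : ℕ}

/-- The operator `opZ` in the coordinates `Z_1^1, …, Z_1^p`. -/
noncomputable def opPartialSums (p j : ℕ) (γ : Fin (p + 1) → ℝ) (f : MvPolynomial (Fin p) ℝ) :
    MvPolynomial (Fin p) ℝ :=
  (∑ k ∈ Finset.range j, ∑ l ∈ Finset.range j,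
    (Zsum p (j + 1) * Zsum p (min k l + 1) - Zsum p (k + 1) * Zsum p (l + 1)) *
      derivZ p k (derivZ p l f)) +
  ∑ k ∈ Finset.range j, (MvPolynomial.C (levelParam γ k + 1) * Zsum p (j + 1) -
    MvPolynomial.C (levelParam γ j + 1) * Zsum p (k + 1)) * derivZ p k f

theorem sum_sum_eq_of_symm {R : Type*} [CommRing R] {p : ℕ} (T : Fin p → Fin p → R)
    (hT : ∀ l m, T l m = T m l) :
    ∑ l, ∑ m, T l m = 2 * (∑ l, ∑ m, if l < m then T l m else 0) + ∑ m, T m m := by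
  have h1 : ∑ l, ∑ m, T l m = ∑ l, ∑ m, ((if l < m then T l m else 0) +
      (if m < l then T l m else 0) + if l = m then T l m else 0) := by
    refine Finset.sum_congr rfl fun l _ => Finset.sum_congr rfl fun m _ => ?_
    rcases lt_trichotomy l m with h | h | h
    · simp [h, h.ne, not_lt.mpr h.le]
    · simp [h]
    · simp [h, h.ne', not_lt.mpr h.le]
  have h2 : ∑ l, ∑ m, (if m < l then T l m else 0) = ∑ l, ∑ m, if l < m then T l m else 0 := by
    rw [Finset.sum_comm]
    refine Finset.sum_congr rfl fun l _ => Finset.sum_congr rfl fun m _ => ?_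
    rw [hT]
  simp only [h1, Finset.sum_add_distrib, h2]
  simp
  ring

/-- The weights `z_m` for `m ≤ j + 1`, and `0` for larger `m`. -/
noncomputable def truncX (p j : ℕ) (m : Fin p) : MvPolynomial (Fin p) ℝ :=
  if (m : ℕ) < j + 1 then MvPolynomial.X m else 0

theorem sum_truncX {j k : ℕ} (hk : k < p) :
    (∑ m : Fin p, if (m : ℕ) ≤ k then truncX p j m else 0) = Zsum p (min k j + 1) := by
  rw [Zsum, if_pos (by omega), psum]
  refine Finset.sum_congr rfl fun m _ => ?_
  unfold truncX
  split_ifs <;> first | rfl | omega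

theorem sum_mul_pderiv (a : Fin p → MvPolynomial (Fin p) ℝ) (f : MvPolynomial (Fin p) ℝ) :
    ∑ m, a m * MvPolynomial.pderiv m f =
      ∑ k ∈ Finset.range p, (∑ m : Fin p, if (m : ℕ) ≤ k then a m else 0) * derivZ p k f := by
  simp only [pderiv_eq_sum_derivZ, Finset.mul_sum, Finset.sum_mul]
  rw [Finset.sum_comm]
  refine Finset.sum_congr rfl fun k _ => Finset.sum_congr rfl fun m _ => ?_
  split_ifs <;> simp

theorem sum_mul_pderiv_pderiv (a : Fin p → Fin p → MvPolynomial (Fin p) ℝ)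
    (f : MvPolynomial (Fin p) ℝ) :
    ∑ l, ∑ m, a l m * MvPolynomial.pderiv l (MvPolynomial.pderiv m f) =
      ∑ k ∈ Finset.range p, ∑ k' ∈ Finset.range p,
        (∑ l : Fin p, ∑ m : Fin p, if (l : ℕ) ≤ k ∧ (m : ℕ) ≤ k' then a l m else 0) *
          derivZ p k (derivZ p k' f) := by
  have h : ∀ l m : Fin p, a l m * MvPolynomial.pderiv l (MvPolynomial.pderiv m f) =
      ∑ k ∈ Finset.range p, ∑ k' ∈ Finset.range p,
        (if (l : ℕ) ≤ k ∧ (m : ℕ) ≤ k' then a l m else 0) * derivZ p k (derivZ p k' f) := by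
    intro l m
    rw [pderiv_eq_sum_derivZ l, Finset.mul_sum]
    refine Finset.sum_congr rfl fun k _ => ?_
    rw [pderiv_eq_sum_derivZ m, map_sum]
    split_ifs with hl
    · rw [Finset.mul_sum]
      refine Finset.sum_congr rfl fun k' _ => ?_
      split_ifs <;> simp_all
    · rw [mul_zero]
      refine (Finset.sum_eq_zero fun k' _ => ?_).symm
      rw [if_neg fun h => hl h.1, zero_mul]
  simp only [h, Finset.sum_mul]
  calc _ = ∑ l : Fin p, ∑ k ∈ Finset.range p, ∑ m : Fin p, ∑ k' ∈ Finset.range p,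
        (if (l : ℕ) ≤ k ∧ (m : ℕ) ≤ k' then a l m else 0) * derivZ p k (derivZ p k' f) :=
        Finset.sum_congr rfl fun l _ => Finset.sum_comm
    _ = ∑ k ∈ Finset.range p, ∑ l : Fin p, ∑ m : Fin p, ∑ k' ∈ Finset.range p,
        (if (l : ℕ) ≤ k ∧ (m : ℕ) ≤ k' then a l m else 0) * derivZ p k (derivZ p k' f) :=
        Finset.sum_comm
    _ = ∑ k ∈ Finset.range p, ∑ l : Fin p, ∑ k' ∈ Finset.range p, ∑ m : Fin p,
        (if (l : ℕ) ≤ k ∧ (m : ℕ) ≤ k' then a l m else 0) * derivZ p k (derivZ p k' f) :=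
        Finset.sum_congr rfl fun k _ => Finset.sum_congr rfl fun l _ => Finset.sum_comm
    _ = _ := Finset.sum_congr rfl fun k _ => Finset.sum_comm

theorem opZ_eq_sum (j : ℕ) (γ : Fin (p + 1) → ℝ) (f : MvPolynomial (Fin p) ℝ) :
    opZ p j γ f =
      (∑ l : Fin p, ∑ m : Fin p, ((if l = m then Zsum p (j + 1) * truncX p j m else 0) -
        truncX p j l * truncX p j m) * MvPolynomial.pderiv l (MvPolynomial.pderiv m f)) +
      ∑ m : Fin p, (if (m : ℕ) < j + 1 then MvPolynomial.C (γ m.castSucc + 1) * Zsum p (j + 1)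
        - MvPolynomial.C (psum γ (j + 1) + j + 1) * MvPolynomial.X m else 0) *
          MvPolynomial.pderiv m f := by
  have hs := sum_sum_eq_of_symm (fun l m : Fin p => truncX p j l * truncX p j m *
    MvPolynomial.pderiv l (MvPolynomial.pderiv m f)) (fun l m => by
      rw [pderiv_pderiv_comm l m]; ring)
  simp only [sub_mul, Finset.sum_sub_distrib, ite_mul, zero_mul, Finset.sum_ite_eq, Finset.mem_univ,
    if_true]
  rw [hs]
  unfold opZ
  have e1 : (∑ l : Fin p, ∑ m : Fin p, if l < m ∧ (m : ℕ) < j + 1 then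
      MvPolynomial.X l * MvPolynomial.X m * MvPolynomial.pderiv l (MvPolynomial.pderiv m f)
      else 0) = ∑ l : Fin p, ∑ m : Fin p, if l < m then truncX p j l * truncX p j m *
        MvPolynomial.pderiv l (MvPolynomial.pderiv m f) else 0 := by
    refine Finset.sum_congr rfl fun l _ => Finset.sum_congr rfl fun m _ => ?_
    unfold truncX
    by_cases h1 : l < m
    · have : (l : ℕ) < m := h1
      by_cases h2 : (m : ℕ) < j + 1
      · rw [if_pos ⟨h1, h2⟩, if_pos h1, if_pos h2, if_pos (by omega)]
      · rw [if_neg (fun h => h2 h.2), if_pos h1, if_neg h2]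
        simp
    · rw [if_neg (fun h => h1 h.1), if_neg h1]
  have e2 : (∑ m : Fin p, if (m : ℕ) < j + 1 then
      MvPolynomial.X m * (Zsum p (j + 1) - MvPolynomial.X m) *
        MvPolynomial.pderiv m (MvPolynomial.pderiv m f) else 0) =
      (∑ m : Fin p, Zsum p (j + 1) * truncX p j m *
        MvPolynomial.pderiv m (MvPolynomial.pderiv m f)) -
      ∑ m : Fin p, truncX p j m * truncX p j m *
        MvPolynomial.pderiv m (MvPolynomial.pderiv m f) := by
    rw [← Finset.sum_sub_distrib]
    refine Finset.sum_congr rfl fun m _ => ?_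
    unfold truncX
    split_ifs
    · ring
    · simp
  rw [e1, e2]
  simp only [sub_mul]
  ring

theorem psum_castSucc_eq (γ : Fin (p + 1) → ℝ) {k : ℕ} (hk : k < p) :
    (∑ m : Fin p, if (m : ℕ) ≤ k then γ m.castSucc else 0) = psum γ (k + 1) := by
  rw [psum, Fin.sum_univ_castSucc]
  simp only [Fin.val_castSucc, Fin.val_last, Nat.lt_succ_iff]
  rw [if_neg (by omega), add_zero]

theorem sum_le_eq_min {R : Type*} [AddCommMonoid R] (a : Fin p → R) (k k' : ℕ) :
    (∑ l : Fin p, ∑ m : Fin p, if (l : ℕ) ≤ k ∧ (m : ℕ) ≤ k' then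
      (if l = m then a m else 0) else 0) =
      ∑ m : Fin p, if (m : ℕ) ≤ min k k' then a m else 0 := by
  refine Finset.sum_congr rfl fun l _ => ?_
  rw [Finset.sum_eq_single l]
  · simp
  · intro m _ hm
    rw [if_neg (Ne.symm hm), ite_self]
  · simp

/-- Summing coefficients over `l ≤ k`, `m ≤ k'` produces partial sums truncated at `Z_1^{j+1}`. If
`k` or `k'` is at least `j`, the two products coincide and cancel: the operator does not
differentiate in `Z_1^{j+1}` or beyond. -/
theorem opZ_eq_opPartialSums {j : ℕ} (hjp : j ≤ p) (γ : Fin (p + 1) → ℝ)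
    (f : MvPolynomial (Fin p) ℝ) : opZ p j γ f = opPartialSums p j γ f := by
  rw [opZ_eq_sum, sum_mul_pderiv_pderiv, sum_mul_pderiv, opPartialSums]
  have hA : ∀ k < p, ∀ k' < p, (∑ l : Fin p, ∑ m : Fin p, if (l : ℕ) ≤ k ∧ (m : ℕ) ≤ k' then
      ((if l = m then Zsum p (j + 1) * truncX p j m else 0) - truncX p j l * truncX p j m) else 0) =
      Zsum p (j + 1) * Zsum p (min (min k k') j + 1) -
        Zsum p (min k j + 1) * Zsum p (min k' j + 1) := by
    intro k hk k' hk'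
    rw [← sum_truncX hk, ← sum_truncX hk', ← sum_truncX (k := min k k') (by omega),
      Finset.sum_mul_sum, Finset.mul_sum]
    simp only [mul_ite, mul_zero]
    rw [← sum_le_eq_min (fun m => Zsum p (j + 1) * truncX p j m), ← Finset.sum_sub_distrib]
    refine Finset.sum_congr rfl fun l _ => ?_
    rw [← Finset.sum_sub_distrib]
    refine Finset.sum_congr rfl fun m _ => ?_
    by_cases h1 : (l : ℕ) ≤ k <;> by_cases h2 : (m : ℕ) ≤ k' <;> simp [h1, h2]
  have hB : ∀ k < p, (∑ m : Fin p, if (m : ℕ) ≤ k then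
      (if (m : ℕ) < j + 1 then MvPolynomial.C (γ m.castSucc + 1) * Zsum p (j + 1)
        - MvPolynomial.C (psum γ (j + 1) + j + 1) * MvPolynomial.X m else 0) else 0) =
      MvPolynomial.C (levelParam γ (min k j) + 1) * Zsum p (j + 1) -
        MvPolynomial.C (levelParam γ j + 1) * Zsum p (min k j + 1) := by
    intro k hk
    have h1 : MvPolynomial.C (levelParam γ (min k j) + 1) =
        ∑ m : Fin p, if (m : ℕ) ≤ min k j then
          (MvPolynomial.C (γ m.castSucc + 1) : MvPolynomial (Fin p) ℝ) else 0 := by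
      have : levelParam γ (min k j) + 1 =
          ∑ m : Fin p, if (m : ℕ) ≤ min k j then γ m.castSucc + 1 else 0 := by
        have hc : ∑ m : Fin p, (if (m : ℕ) ≤ min k j then (1 : ℝ) else 0) =
            ((min k j : ℕ) : ℝ) + 1 := by
          rw [Finset.sum_ite, Finset.sum_const_zero, add_zero, Finset.sum_const, nsmul_eq_mul,
            mul_one, show (Finset.univ.filter fun m : Fin p => (m : ℕ) ≤ min k j) =
              Finset.Iic ⟨min k j, by omega⟩ by ext m; simp [Fin.le_def], Fin.card_Iic]
          push_cast
          rfl
        rw [levelParam, ← psum_castSucc_eq γ (show min k j < p by omega), add_assoc, ← hc,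
          ← Finset.sum_add_distrib]
        refine Finset.sum_congr rfl fun m _ => ?_
        split_ifs <;> simp
      rw [this, map_sum]
      refine Finset.sum_congr rfl fun m _ => ?_
      split_ifs <;> simp
    rw [h1, ← sum_truncX hk, Finset.sum_mul, Finset.mul_sum, ← Finset.sum_sub_distrib]
    refine Finset.sum_congr rfl fun m _ => ?_
    unfold truncX levelParam
    by_cases h1 : (m : ℕ) ≤ k <;> by_cases h2 : (m : ℕ) < j + 1
    · rw [if_pos h1, if_pos h2, if_pos (by omega), if_pos h1, if_pos h2]
    · rw [if_pos h1, if_neg h2, if_neg (by omega), if_pos h1, if_neg h2]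
      simp
    · rw [if_neg h1, if_neg (by omega), if_neg h1]
      simp
    · rw [if_neg h1, if_neg (by omega), if_neg h1]
      simp
  have hsub : Finset.range j ⊆ Finset.range p := Finset.range_subset_range.mpr hjp
  congr 1
  · symm
    refine Finset.sum_subset_zero_on_sdiff hsub ?_ ?_
    · intro k hk
      simp only [Finset.mem_sdiff, Finset.mem_range] at hk
      refine Finset.sum_eq_zero fun k' hk' => ?_
      rw [hA k hk.1 k' (Finset.mem_range.mp hk'), show min (min k k') j = min k' j by omega,
        show min k j = j by omega, sub_self, zero_mul]
    · intro k hk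
      have hk1 := Finset.mem_range.mp hk
      refine Finset.sum_subset_zero_on_sdiff hsub ?_ ?_
      · intro k' hk'
        simp only [Finset.mem_sdiff, Finset.mem_range] at hk'
        rw [hA k (by omega) k' hk'.1, show min (min k k') j = min k j by omega,
          show min k' j = j by omega, mul_comm (Zsum p (min k j + 1)), sub_self, zero_mul]
      · intro k' hk'
        have hk2 := Finset.mem_range.mp hk'
        rw [hA k (by omega) k' (by omega), show min (min k k') j = min k k' by omega,
          show min k j = k by omega, show min k' j = k' by omega]
  · symm
    refine Finset.sum_subset_zero_on_sdiff hsub ?_ ?_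
    · intro k hk
      simp only [Finset.mem_sdiff, Finset.mem_range] at hk
      rw [hB k hk.1, show min k j = j by omega, sub_self, zero_mul]
    · intro k hk
      have hk1 := Finset.mem_range.mp hk
      rw [hB k (by omega), show min k j = k by omega]

end opZ

/-! ### The eigenvalue equation by induction on `j`. -/

section eigen
variable {p : ℕ}

/-- The Euler operator `∑_{k ≤ j} Z_k ∂_{Z_k}`. -/
noncomputable def eulerZ (p j : ℕ) :
    Derivation ℝ (MvPolynomial (Fin p) ℝ) (MvPolynomial (Fin p) ℝ) :=
  ∑ k ∈ Finset.range (j + 1), Zsum p (k + 1) • derivZ p k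

theorem eulerZ_apply (j : ℕ) (f : MvPolynomial (Fin p) ℝ) :
    eulerZ p j f = ∑ k ∈ Finset.range (j + 1), Zsum p (k + 1) * derivZ p k f := by
  rw [eulerZ, sum_derivation_apply]
  rfl

theorem eulerZ_Zsum {j : ℕ} (hj : j < p) (l : ℕ) :
    eulerZ p j (Zsum p (l + 1)) = if l ≤ j then Zsum p (l + 1) else 0 := by
  rw [eulerZ_apply, Finset.sum_congr rfl fun k hk => by
    rw [derivZ_Zsum (by have := Finset.mem_range.mp hk; omega)]]
  simp

theorem eulerZ_eulerZ {j : ℕ} (hj : j < p) (f : MvPolynomial (Fin p) ℝ) :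
    eulerZ p j (eulerZ p j f) - eulerZ p j f =
      ∑ k ∈ Finset.range (j + 1), ∑ l ∈ Finset.range (j + 1),
        Zsum p (k + 1) * Zsum p (l + 1) * derivZ p k (derivZ p l f) := by
  rw [eulerZ_apply j (eulerZ p j f), eulerZ_apply, ← Finset.sum_sub_distrib]
  refine Finset.sum_congr rfl fun k hk => ?_
  have hk' := Finset.mem_range.mp hk
  rw [map_sum, Finset.mul_sum]
  have : ∀ l ∈ Finset.range (j + 1), Zsum p (k + 1) * derivZ p k (Zsum p (l + 1) * derivZ p l f) =
      Zsum p (k + 1) * Zsum p (l + 1) * derivZ p k (derivZ p l f) +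
        if k = l then Zsum p (k + 1) * derivZ p l f else 0 := by
    intro l _
    rw [Derivation.leibniz, derivZ_Zsum (by omega)]
    simp only [smul_eq_mul]
    split_ifs <;> ring
  rw [Finset.sum_congr rfl this, Finset.sum_add_distrib, Finset.sum_ite_eq, if_pos hk,
    add_sub_cancel_right]

/-- The added terms have coefficient zero; the longer ranges match those of `eulerZ p j`. -/
theorem opPartialSums_eq_range_succ (j : ℕ) (γ : Fin (p + 1) → ℝ) (f : MvPolynomial (Fin p) ℝ) :
    opPartialSums p j γ f =
      (∑ k ∈ Finset.range (j + 1), ∑ l ∈ Finset.range (j + 1),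
        (Zsum p (j + 1) * Zsum p (min k l + 1) - Zsum p (k + 1) * Zsum p (l + 1)) *
          derivZ p k (derivZ p l f)) +
      ∑ k ∈ Finset.range (j + 1), (MvPolynomial.C (levelParam γ k + 1) * Zsum p (j + 1) -
        MvPolynomial.C (levelParam γ j + 1) * Zsum p (k + 1)) * derivZ p k f := by
  unfold opPartialSums
  congr 1
  · rw [Finset.sum_range_succ, Finset.sum_eq_zero (s := Finset.range (j + 1)), add_zero]
    · refine Finset.sum_congr rfl fun k hk => ?_
      have := Finset.mem_range.mp hk
      rw [Finset.sum_range_succ, show min k j = k by omega, mul_comm (Zsum p (j + 1)), sub_self,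
        zero_mul, add_zero]
    · intro l hl
      have := Finset.mem_range.mp hl
      rw [show min j l = l by omega, sub_self, zero_mul]
  · rw [Finset.sum_range_succ, sub_self, zero_mul, add_zero]

/-- The recursion in `j` of the differential operators. -/
theorem mul_opPartialSums_succ {j : ℕ} (hj : j < p) (γ : Fin (p + 1) → ℝ)
    (f : MvPolynomial (Fin p) ℝ) :
    Zsum p (j + 1) * opPartialSums p (j + 1) γ f =
      Zsum p (j + 2) * opPartialSums p j γ f +
      (Zsum p (j + 2) - Zsum p (j + 1)) * (eulerZ p j (eulerZ p j f) - eulerZ p j f) +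
      (MvPolynomial.C (levelParam γ j + 1) * Zsum p (j + 2) -
        MvPolynomial.C (levelParam γ (j + 1) + 1) * Zsum p (j + 1)) * eulerZ p j f := by
  rw [eulerZ_eulerZ hj, eulerZ_apply, opPartialSums_eq_range_succ j, opPartialSums]
  simp only [mul_add, Finset.mul_sum]
  have e : ∀ a b c d : MvPolynomial (Fin p) ℝ, a + b + c + d = (a + c) + (b + d) :=
    fun a b c d => by ring
  rw [e]
  refine congrArg₂ _ ?_ ?_
  · rw [← Finset.sum_add_distrib]
    refine Finset.sum_congr rfl fun k _ => ?_
    rw [← Finset.sum_add_distrib]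
    refine Finset.sum_congr rfl fun l _ => ?_
    ring
  · rw [← Finset.sum_add_distrib]
    refine Finset.sum_congr rfl fun k _ => ?_
    ring

/-- The eigenvalue of the operator of order `j`, as a function of `d = n_1 + ⋯ + n_j`. -/
theorem muHat_eq (j : ℕ) (γ : Fin (p + 1) → ℝ) (n : Fin p → ℕ) :
    muHat p j γ n = -((psum n j : ℕ) : ℝ) * (((psum n j : ℕ) : ℝ) + levelParam γ j) := by
  unfold muHat levelParam
  ring

/-- The `i`-th factor of the Jacobi polynomial on the simplex, without normalization. -/
noncomputable def homFactor (γ : Fin (p + 1) → ℝ) (n : Fin p → ℕ) (i : ℕ) :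
    MvPolynomial (Fin p) ℝ :=
  jacobiHom (psum n (i + 1) - psum n i) (2 * ((psum n i : ℕ) : ℝ) + levelParam γ i)
    (levelParam γ (i + 1) - levelParam γ i - 1) (Zsum p (i + 1)) (Zsum p (i + 2))

theorem derivZ_homFactor_eq_zero (γ : Fin (p + 1) → ℝ) (n : Fin p → ℕ) {k i : ℕ} (hk : k < p)
    (hki : k < i) : derivZ p k (homFactor γ n i) = 0 := by
  refine derivation_jacobiHom_eq_zero _ ?_ ?_ _ _ _
  · rw [derivZ_Zsum hk, if_neg (by omega)]
  · rw [show i + 2 = i + 1 + 1 from rfl, derivZ_Zsum hk, if_neg (by omega)]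

theorem derivation_prod_of_eigen {ι : Type*}
    (E : Derivation ℝ (MvPolynomial (Fin p) ℝ) (MvPolynomial (Fin p) ℝ)) (s : Finset ι)
    (f : ι → MvPolynomial (Fin p) ℝ) (x : ι → ℝ) (h : ∀ i ∈ s, E (f i) = MvPolynomial.C (x i) * f i) :
    E (∏ i ∈ s, f i) = MvPolynomial.C (∑ i ∈ s, x i) * ∏ i ∈ s, f i := by
  classical
  induction s using Finset.induction_on with
  | empty => simp
  | insert a s ha ih =>
    rw [Finset.prod_insert ha, Finset.sum_insert ha, Derivation.leibniz,
      ih fun i hi => h i (Finset.mem_insert_of_mem hi), h a (Finset.mem_insert_self a s), map_add]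
    simp only [smul_eq_mul]
    ring

theorem eulerZ_prod_homFactor (γ : Fin (p + 1) → ℝ) (n : Fin p → ℕ) {j : ℕ} (hj : j < p) :
    eulerZ p j (∏ i ∈ Finset.range j, homFactor γ n i) =
      MvPolynomial.C ((psum n j : ℕ) : ℝ) * ∏ i ∈ Finset.range j, homFactor γ n i := by
  rw [derivation_prod_of_eigen _ _ _ (fun i => ((psum n (i + 1) - psum n i : ℕ) : ℝ))]
  · congr 2
    rw [← Nat.cast_sum]
    congr 1
    induction j with
    | zero => simp [psum_zero]
    | succ j ih =>
      rw [Finset.sum_range_succ, ih (by omega), Nat.add_sub_cancel' (psum_mono n (Nat.le_succ j))]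
  · intro i hi
    have := Finset.mem_range.mp hi
    refine euler_jacobiHom _ ?_ ?_ _ _ _
    · rw [eulerZ_Zsum hj, if_pos (by omega)]
    · rw [show i + 2 = i + 1 + 1 from rfl, eulerZ_Zsum hj, if_pos (by omega)]

theorem Zsum_ne_zero (hp : 0 < p) (k : ℕ) : Zsum p (k + 1) ≠ 0 := by
  intro h
  have := eval_Zsum hp k
  rw [h, map_zero] at this
  exact zero_ne_one this

/-- The general `ψ` drives the induction: factor `j` depends only on `Z_1^{j+1}` and `Z_1^{j+2}`, so
it is a constant for the operator of order `j` and is absorbed into `ψ`. For the Euler operator the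
product of the first `j` factors is homogeneous of degree `N_1^j`, and what remains of the recursion
is the Jacobi equation of factor `j`. -/
theorem opPartialSums_prod_homFactor (γ : Fin (p + 1) → ℝ) (n : Fin p → ℕ) {j : ℕ} (hjp : j ≤ p)
    (ψ : MvPolynomial (Fin p) ℝ) (hψ : ∀ k < j, derivZ p k ψ = 0) :
    opPartialSums p j γ ((∏ i ∈ Finset.range j, homFactor γ n i) * ψ) =
      MvPolynomial.C (muHat p j γ n) * ((∏ i ∈ Finset.range j, homFactor γ n i) * ψ) := by
  induction j generalizing ψ with
  | zero => simp [opPartialSums, muHat, psum_zero]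
  | succ j ih =>
    have hj : j < p := hjp
    have hprod : (∏ i ∈ Finset.range (j + 1), homFactor γ n i) * ψ =
        (∏ i ∈ Finset.range j, homFactor γ n i) * (homFactor γ n j * ψ) := by
      rw [Finset.prod_range_succ, mul_assoc]
    have hE := eulerZ_prod_homFactor γ n hj
    have hEψ : eulerZ p j ψ = 0 := by
      rw [eulerZ_apply]
      exact Finset.sum_eq_zero fun k hk => by rw [hψ k (Finset.mem_range.mp hk), mul_zero]
    have hker : ∀ k < j, derivZ p k (homFactor γ n j * ψ) = 0 := by
      intro k hk
      rw [Derivation.leibniz, hψ k (by omega), derivZ_homFactor_eq_zero γ n (by omega) hk]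
      simp
    have hode := jacobiHom_ode (eulerZ p j) (u := Zsum p (j + 1)) (v := Zsum p (j + 2))
      (by rw [eulerZ_Zsum hj, if_pos le_rfl])
      (by rw [show j + 2 = j + 1 + 1 from rfl, eulerZ_Zsum hj, if_neg (by omega)])
      (psum n (j + 1) - psum n j) (2 * ((psum n j : ℕ) : ℝ) + levelParam γ j)
      (levelParam γ (j + 1) - levelParam γ j - 1)
    rw [← homFactor, Nat.cast_sub (psum_mono n (Nat.le_succ j))] at hode
    apply mul_left_cancel₀ (Zsum_ne_zero (by omega : 0 < p) j)
    rw [mul_opPartialSums_succ hj, hprod, ih (by omega) _ hker]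
    have hC : ∀ x : ℝ, eulerZ p j (MvPolynomial.C x) = 0 := by
      intro x
      rw [← MvPolynomial.algebraMap_eq]
      exact (eulerZ p j).map_algebraMap x
    simp only [Derivation.leibniz, hE, hEψ, hC, smul_eq_mul, map_add, mul_zero, zero_add]
    simp only [muHat_eq]
    generalize eulerZ p j (eulerZ p j (homFactor γ n j)) = φ'' at hode ⊢
    generalize eulerZ p j (homFactor γ n j) = φ' at hode ⊢
    generalize homFactor γ n j = φ at hode ⊢
    generalize ∏ i ∈ Finset.range j, homFactor γ n i = H
    simp only [map_mul, map_add, map_sub, map_neg, map_one, map_ofNat] at hode ⊢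
    linear_combination (H * ψ) * hode

theorem opZ_jacobiSimplex {j : ℕ} (hjp : j ≤ p) (γ : Fin (p + 1) → ℝ) (n : Fin p → ℕ) :
    opZ p j γ (jacobiSimplex p γ n) = MvPolynomial.C (muHat p j γ n) * jacobiSimplex p γ n := by
  obtain ⟨x, hx⟩ : ∃ x : ℝ, jacobiSimplex p γ n =
      MvPolynomial.C x * ∏ i ∈ Finset.range p, homFactor γ n i := by
    refine ⟨(-1) ^ (∑ k, n k) * ∏ k : Fin p, ((n k).factorial : ℝ) / poch (γ k.succ + 1) (n k), ?_⟩
    have h : ∏ k : Fin p, (MvPolynomial.C (((n k).factorial : ℝ) / poch (γ k.succ + 1) (n k)) *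
        jacobiHom (n k) (2 * ((psum n (k : ℕ) : ℕ) : ℝ) + psum γ ((k : ℕ) + 1) + (k : ℕ)) (γ k.succ)
          (Zsum p ((k : ℕ) + 1)) (Zsum p ((k : ℕ) + 2))) =
        MvPolynomial.C (∏ k : Fin p, ((n k).factorial : ℝ) / poch (γ k.succ + 1) (n k)) *
          ∏ i ∈ Finset.range p, homFactor γ n i := by
      rw [map_prod MvPolynomial.C, Finset.prod_range, ← Finset.prod_mul_distrib]
      refine Finset.prod_congr rfl fun k _ => ?_
      rw [homFactor, levelParam_succ_sub γ k.2, psum_succ n k.2, Nat.add_sub_cancel_left,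
        add_sub_cancel_right, levelParam, add_assoc (2 * _)]
    rw [jacobiSimplex, h, MvPolynomial.C_mul, mul_assoc]
  have hsplit : jacobiSimplex p γ n = (∏ i ∈ Finset.range j, homFactor γ n i) *
      (MvPolynomial.C x * ∏ i ∈ Finset.Ico j p, homFactor γ n i) := by
    rw [hx, Finset.range_eq_Ico, ← Finset.prod_Ico_consecutive _ (Nat.zero_le j) hjp,
      ← Finset.range_eq_Ico]
    ring
  rw [opZ_eq_opPartialSums hjp, hsplit]
  refine opPartialSums_prod_homFactor γ n hjp _ fun k hk => ?_
  rw [Derivation.leibniz, MvPolynomial.derivation_C, derivation_prod_of_eigen _ _ _ (fun _ => 0)]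
  · simp
  · intro i hi
    rw [derivZ_homFactor_eq_zero γ n (by omega) (by have := Finset.mem_Ico.mp hi; omega)]
    simp

end eigen

end SimplexJacobi

theorem theorem5p4 (p j : ℕ) (hj1 : 1 ≤ j) (hjp : j ≤ p) (γ : Fin (p + 1) → ℝ)
    (hγ : ∀ k : Fin p, ∀ i : ℕ, γ k.succ + 1 + i ≠ 0) (n : Fin p → ℕ) :
    -- the differential equation in `z`
    opZ p j γ (jacobiSimplex p γ n) =
        MvPolynomial.C (muHat p j γ n) * jacobiSimplex p γ n ∧
    -- the limits that define the coefficients of the operator in `n` exist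
    (∀ γ' ∈ genericParams p j n, ∀ ν : Fin j → SignType, ν ≠ 0 →
      (∀ N : ℝ, Tendsto (fun β₀ : ℝ => coeffRacah p j γ' β₀ N n ν / β₀) atTop
        (𝓝 (coeffHahn p j γ' N n ν))) ∧
      Tendsto (fun N : ℝ => coeffHahn p j γ' N n ν / N) atTop (𝓝 (coeffJacobi p j γ' n ν))) ∧
    -- the coefficients are well defined and the difference equation in `n` holds,
    -- whatever values are given to the Jacobi polynomials at indices outside `ℕ^p`
    ((γ ∈ genericParams p j n ∨ ∀ i, -1 < γ i) →
      (∀ ν : Fin j → SignType, ν ≠ 0 →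
        Tendsto (fun γ' => coeffJacobi p j γ' n ν) (𝓝[genericParams p j n] γ)
          (𝓝 (coeffN p j γ n ν))) ∧
      ∀ F : (Fin p → ℤ) → MvPolynomial (Fin p) ℝ,
        (∀ m : Fin p → ℕ, F (fun i => (m i : ℤ)) = jacobiSimplex p γ m) →
        opN p j γ F n = kappaHat p j * jacobiSimplex p γ n) := by
  refine ⟨opZ_jacobiSimplex hjp γ n, fun γ' _ ν _ => ⟨fun N => ?_, ?_⟩, fun h => ⟨fun ν _ => ?_, ?_⟩⟩
  · rw [coeffHahn_eq hj1 hjp]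
    exact tendsto_coeffRacah hj1 hjp γ' N n ν
  · rw [coeffJacobi_eq hj1 hjp]
    exact tendsto_coeffHahn hj1 hjp γ' n ν
  · rw [coeffN_eq hj1 hjp (regularParams_of hjp h)]
    exact tendsto_coeffJacobi hj1 hjp (regularParams_of hjp h) ν
  · exact opN_jacobiSimplex hγ hj1 hjp (regularParams_of hjp h)
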